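/- **Setting.** There are $n$ men and $n$ women. Each player $v$ has a preference list, a linear order on a set of $\deg v$ members of the opposite sex; lists are symmetric ($u$ is on $v$'s list iff $v$ is on $u$'s list). The communication graph $G$ joins players who rank each other. Fix $c\in\mathbb N$; every player has a unique identifier in $\{0,\dots,n^c-1\}$ and knows its gender, its identifier, $n$, $\varepsilon$ and its own preference list (as identifiers). In the CONGEST model, in every synchronous round each player may send to each neighbour in $G$ a (possibly different) bit string, and then updates its state by an arbitrary deterministic local computation; messages must have $O(\log n)$ bits, and complexity is the number of rounds. **Algorithm $\mathrm{ASM}(P,\varepsilon,n)$.** Let $k=\lceil 8/\varepsilon\rceil$ and $\delta=\varepsilon/8$. Player $v$ splits its list into $k$ quantiles, the partner of rank $r$ being in quantile $\lceil rk/\deg v\rceil$. $Q$ is the set of partners not yet removed, $Q_i$ its part in quantile $i$, $p$ the current partner (initially none), and, for men, $A$ is a set of active potential mates (initially $Q_1$). * $\mathrm{ProposalRound}$: (1) each participating man proposes to all women in $A$; (2) each woman accepts all proposals from the best quantile from which she received one; (3) a subroutine $\mathrm{MaximalMatching}$ is run on the graph $G_0$ of accepted proposals, giving each player a partner $p_0$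 or none; (4) each woman with a partner $p_0$ rejects all men of $Q$ in a lesser or equal quantile than $p_0$, other than $p_0$, removes them from $Q$, and sets $p\leftarrow p_0$; each man with a partner $p_0$ sets $p\leftarrow p_0$, $A\leftarrow\varnothing$; (5) men remove the women who rejected them from $Q$ and $A$, and set $p\leftarrow\varnothing$ if rejected by $p$. * $\mathrm{QuantileMatch}$: each participating man without a partner sets $A\leftarrow Q_i$ with $i=\min(\{i: Q_i\ne\varnothing\}\cup\{k\})$; then $\mathrm{ProposalRound}$ is called $k$ times. * $\mathrm{ASM}$: for each integer $i$ with $0\le i\le\log_2 n$, the men with $|Q|\ge 2^i$ are made the participating men, and then $\mathrm{QuantileMatch}$ is called once for each integer $j$ with $1\le j\le 2\delta^{-1}k$. **Theorem.** For every $c$ there are a deterministic CONGEST algorithm $\mathrm{MaximalMatching}$ and a constant $C$ such that, for every $n\ge 2$ and all unique identifiers as above: 1. On every bipartite graph between the $n$ men and the $n$ women, $\mathrm{MaximalMatching}$ finds a maximal matching (each player outputs the identifier of its partner, or nothing if it is unmatched), in at most $C\log^4 n$ rounds and with messages of at most $C\log n$ bits. 2. For all preferences $P$ and all $\varepsilon>0$,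 $\mathrm{ASM}(P,\varepsilon,n)$ with this subroutine runs in at most $C\varepsilon^{-3}\log^5 n$ communication rounds, with messages of at most $C\log n$ bits. More precisely, it makes at most $C\varepsilon^{-2}\log n$ calls to $\mathrm{QuantileMatch}$; its number of calls to $\mathrm{ProposalRound}$ is at most $C\varepsilon^{-1}$ times the number of calls to $\mathrm{QuantileMatch}$; and its number of rounds is at most $C\log^4 n$ times the number of calls to $\mathrm{ProposalRound}$. -/

import Mathlib

namespace AlmostStable

/-! ## Players and preferences -/

inductive Gender where
  | male
  | female
  deriving DecidableEq

/-- `n` men (left summand) and `n` women (right summand). -/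
abbrev Player (n : ℕ) : Type := Fin n ⊕ Fin n

def gender {n : ℕ} : Player n → Gender
  | Sum.inl _ => Gender.male
  | Sum.inr _ => Gender.female

/-- Symmetric, possibly incomplete preferences: `list v` is the preference list of `v`,
the most favoured partner first. -/
structure Preferences (n : ℕ) where
  list : Player n → List (Player n)
  nodup : ∀ v, (list v).Nodup
  opposite : ∀ v u, u ∈ list v → gender u ≠ gender v
  symm : ∀ v u, u ∈ list v → v ∈ list u

/-- The communication graph: players are adjacent when they rank each other. -/
def Preferences.graph {n : ℕ} (P : Preferences n) : SimpleGraph (Player n) where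
  Adj v u := u ∈ P.list v
  symm := ⟨fun v u h => P.symm v u h⟩
  loopless := ⟨fun v h => P.opposite v v h rfl⟩

/-- Every edge joins a man and a woman. -/
def IsBipartite {n : ℕ} (G : SimpleGraph (Player n)) : Prop :=
  ∀ v u, G.Adj v u → gender v ≠ gender u

/-- Unique identifiers from a range of size `n ^ c`, i.e. identifiers of `O(log n)` bits. -/
def ValidIds {n : ℕ} (c : ℕ) (ident : Player n → ℕ) : Prop :=
  Function.Injective ident ∧ ∀ v, ident v < n ^ c

/-! ## The CONGEST model

Processors sit at the vertices of a graph and only refer to their neighbours by identifier. In a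
synchronous round every processor sends a bit string (or nothing) to each of its neighbours, and
then updates its state according to what it has received. Local computation is free. -/

abbrev Message : Type := List Bool

/-- Messages received by one processor, indexed by the identifier of the sender. -/
abbrev Inbox : Type := ℕ → Option Message

/-- The number of bits in a message; sending nothing costs no bits. -/
def messageBits : Option Message → ℕ
  | none => 0
  | some msg => msg.length

/-- An execution in progress: the states of all processors, with a record of the resources that
have been used. -/
structure Exec (V σ : Type) where
  state : V → σ
  /-- communication rounds so far -/
  rounds : ℕ := 0
  /-- length of the longest message sent so far -/
  bits : ℕ := 0
  /-- calls to `quantileMatch` so far -/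
  quantileMatchCalls : ℕ := 0
  /-- calls to `proposalRound` so far -/
  proposalRoundCalls : ℕ := 0

open Classical in
/-- What `v` receives when each processor `u` sends `out u j` to its neighbour with
identifier `j`. -/
noncomputable def inbox {V : Type} (G : SimpleGraph V) (ident : V → ℕ)
    (out : V → ℕ → Option Message) (v : V) : Inbox :=
  fun j => if h : ∃ u, G.Adj v u ∧ ident u = j then out h.choose (ident v) else none

open Classical in
/-- One communication round on the network `G`. -/
noncomputable def Exec.communicate {V σ : Type} [Fintype V] (G : SimpleGraph V) (ident : V → ℕ)
    (send : σ → ℕ → Option Message) (receive : σ → Inbox → σ) (e : Exec V σ) : Exec V σ :=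
  { e with
    state := fun v => receive (e.state v) (inbox G ident (fun u => send (e.state u)) v)
    rounds := e.rounds + 1
    bits := max e.bits (Finset.univ.sup fun v => Finset.univ.sup fun u =>
      if G.Adj v u then messageBits (send (e.state v) (ident u)) else 0) }

/-- A local computation of every processor, without communication. -/
def Exec.compute {V σ : Type} (f : σ → σ) (e : Exec V σ) : Exec V σ :=
  { e with state := fun v => f (e.state v) }

/-- A deterministic CONGEST algorithm that takes a network of men and women as its input graph and
in which every processor outputs the identifier of a partner, or nothing. The initial state depends
on `n`, on the gender and identifier of the processor, and on the identifiers of its neighbours;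
all processors stop after `time n` rounds. -/
structure MatchingAlgorithm where
  State : Type
  init : ℕ → Gender → ℕ → Finset ℕ → State
  send : State → ℕ → Option Message
  receive : State → Inbox → State
  output : State → Option ℕ
  time : ℕ → ℕ

open Classical in
/-- The complete execution of the algorithm on the network `G`. -/
noncomputable def MatchingAlgorithm.run (MM : MatchingAlgorithm) {n : ℕ}
    (G : SimpleGraph (Player n)) (ident : Player n → ℕ) : Exec (Player n) MM.State :=
  (Exec.communicate G ident MM.send MM.receive)^[MM.time n]
    { state := fun v =>
        MM.init n (gender v) (ident v) ((Finset.univ.filter (G.Adj v)).image ident) }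

/-- `M` is a matching of `G`: a set of edges, no two of which share a vertex. -/
def IsMatching {V : Type} (G : SimpleGraph V) (M : Set (Sym2 V)) : Prop :=
  M ⊆ G.edgeSet ∧ ∀ e ∈ M, ∀ f ∈ M, ∀ v, v ∈ e → v ∈ f → e = f

/-- When the algorithm stops on the network `G`, there is a maximal matching `M` of `G` such that
every processor outputs its partner in `M`, if it has one, and nothing otherwise. -/
def MatchingAlgorithm.FindsMaximalMatching (MM : MatchingAlgorithm) {n : ℕ}
    (G : SimpleGraph (Player n)) (ident : Player n → ℕ) : Prop :=
  ∃ M : Set (Sym2 (Player n)), Maximal (IsMatching G) M ∧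
    ∀ v j, MM.output ((MM.run G ident).state v) = some j ↔ ∃ u, ident u = j ∧ s(v, u) ∈ M

/-! ## The algorithm ASM -/

/-- The state of a processor. Other players are represented by their identifiers. -/
structure PlayerState where
  gender : Gender
  /-- `q u` is the index of the quantile in which the acceptable partner `u` lies -/
  q : ℕ → ℕ
  /-- acceptable partners that have not been removed -/
  Q : Finset ℕ
  /-- current partner -/
  p : Option ℕ
  /-- active potential mates (men only) -/
  A : Finset ℕ
  /-- neighbours in the graph of accepted proposals -/
  G₀ : Finset ℕ
  /-- partner in the maximal matching of the graph of accepted proposals -/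
  p₀ : Option ℕ
  /-- whether a man takes part in the current iteration of the outer loop -/
  active : Bool

/-- The `i`-th quantile of what remains of the preferences. -/
def PlayerState.quantile (s : PlayerState) (i : ℕ) : Finset ℕ :=
  s.Q.filter fun u => s.q u = i

def PROPOSE : Message := [false, false]
def ACCEPT : Message := [false, true]
def REJECT : Message := [true, false]

/-- Those `u ∈ Q` from whom the message `msg` has been received. -/
def PlayerState.sendersOf (s : PlayerState) (msg : Message) (inb : Inbox) : Finset ℕ :=
  s.Q.filter fun u => inb u = some msg

/-- Initial state, for `k` quantiles, of a player with preference list `L`. The player of rank `r`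
(starting from `1`) is in quantile `⌈r k / deg⌉`, so that the `i`-th quantile consists of the ranks
in the interval `((i - 1) deg / k, i deg / k]`. -/
def PlayerState.init (k : ℕ) (g : Gender) (L : List ℕ) : PlayerState :=
  let q : ℕ → ℕ := fun u => ((L.idxOf u + 1) * k) ⌈/⌉ L.length
  { gender := g
    q := q
    Q := L.toFinset
    p := none
    A := if g = Gender.male then L.toFinset.filter (fun u => q u = 1) else ∅
    G₀ := ∅
    p₀ := none
    active := true }

/-- Step 1: men propose to all of `A`. -/
def sendPropose (s : PlayerState) (u : ℕ) : Option Message :=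
  if s.gender = Gender.male ∧ s.active = true ∧ u ∈ s.A then some PROPOSE else none

/-- Women select the proposals from the best quantile from which there is a proposal. -/
def receivePropose (s : PlayerState) (inb : Inbox) : PlayerState :=
  if s.gender = Gender.female then
    { s with G₀ := (s.sendersOf PROPOSE inb).filter fun u =>
        ∀ u' ∈ s.sendersOf PROPOSE inb, s.q u ≤ s.q u' }
  else s

/-- Step 2: women accept the selected proposals. -/
def sendAccept (s : PlayerState) (u : ℕ) : Option Message :=
  if s.gender = Gender.female ∧ u ∈ s.G₀ then some ACCEPT else none

def receiveAccept (s : PlayerState) (inb : Inbox) : PlayerState :=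
  if s.gender = Gender.male then { s with G₀ := s.sendersOf ACCEPT inb } else s

/-- The graph of accepted proposals, as stored by the processors. -/
def acceptedGraph {n : ℕ} (G : SimpleGraph (Player n)) (ident : Player n → ℕ)
    (state : Player n → PlayerState) : SimpleGraph (Player n) where
  Adj v u := G.Adj v u ∧ ident u ∈ (state v).G₀ ∧ ident v ∈ (state u).G₀
  symm := ⟨fun _ _ h => ⟨h.1.symm, h.2.2, h.2.1⟩⟩
  loopless := ⟨fun _ h => G.irrefl h.1⟩

/-- Step 3: `MM` is run on the graph of accepted proposals. -/
noncomputable def matchAccepted (MM : MatchingAlgorithm) {n : ℕ} (G : SimpleGraph (Player n))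
    (ident : Player n → ℕ) (e : Exec (Player n) PlayerState) : Exec (Player n) PlayerState :=
  let r := MM.run (acceptedGraph G ident e.state) ident
  { e with
    state := fun v => { e.state v with p₀ := MM.output (r.state v) }
    rounds := e.rounds + r.rounds
    bits := max e.bits r.bits }

/-- The men that a woman rejects in Step 4: all men in `Q` in a lesser or equal quantile to that of
`p₀`, other than `p₀`. -/
def PlayerState.rejected (s : PlayerState) : Finset ℕ :=
  match s.p₀ with
  | none => ∅
  | some m => s.Q.filter fun u => s.q m ≤ s.q u ∧ u ≠ m

/-- Step 4: the rejections. -/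
def sendReject (s : PlayerState) (u : ℕ) : Option Message :=
  if s.gender = Gender.female ∧ u ∈ s.rejected then some REJECT else none

/-- Steps 4 and 5: the updates of `Q`, `A` and `p`. -/
def receiveReject (s : PlayerState) (inb : Inbox) : PlayerState :=
  match s.gender with
  | Gender.female => { s with Q := s.Q \ s.rejected, p := s.p₀.or s.p }
  | Gender.male =>
      let R := s.sendersOf REJECT inb
      let p := s.p₀.or s.p
      let A := if s.p₀.isSome then ∅ else s.A
      { s with Q := s.Q \ R, A := A \ R, p := p.filter fun w => w ∉ R }

/-- The subroutine **ProposalRound**. -/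
noncomputable def proposalRound (MM : MatchingAlgorithm) {n : ℕ} (G : SimpleGraph (Player n))
    (ident : Player n → ℕ) (e : Exec (Player n) PlayerState) : Exec (Player n) PlayerState :=
  let e := { e with proposalRoundCalls := e.proposalRoundCalls + 1 }
  let e := e.communicate G ident sendPropose receivePropose
  let e := e.communicate G ident sendAccept receiveAccept
  let e := matchAccepted MM G ident e
  e.communicate G ident sendReject receiveReject

/-- First lines of **QuantileMatch**: a participating man without a partner activates his best
nonempty quantile. -/
noncomputable def chooseQuantile (k : ℕ) (s : PlayerState) : PlayerState :=
  if s.gender = Gender.male ∧ s.active = true ∧ s.p = none then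
    { s with A := s.quantile (sInf ({i | (s.quantile i).Nonempty} ∪ {k})) }
  else s

/-- The subroutine **QuantileMatch**. -/
noncomputable def quantileMatch (MM : MatchingAlgorithm) (k : ℕ) {n : ℕ}
    (G : SimpleGraph (Player n)) (ident : Player n → ℕ) (e : Exec (Player n) PlayerState) :
    Exec (Player n) PlayerState :=
  let e := { e with quantileMatchCalls := e.quantileMatchCalls + 1 }
  (proposalRound MM G ident)^[k] (e.compute (chooseQuantile k))

/-- The test at the start of the `i`-th iteration of the outer loop: only men `m` with
`|Q| ≥ 2 ^ i` take part. -/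
def testActive (i : ℕ) (s : PlayerState) : PlayerState :=
  if s.gender = Gender.male then { s with active := decide (2 ^ i ≤ s.Q.card) } else s

/-- The number of quantiles. -/
noncomputable def numQuantiles (ε : ℝ) : ℕ := ⌈8 * ε⁻¹⌉₊

/-- The number of iterations of the inner loop, `2 δ⁻¹ k` with `δ = ε / 8`. -/
noncomputable def numInner (ε : ℝ) : ℕ := ⌊2 * (ε / 8)⁻¹ * (numQuantiles ε : ℝ)⌋₊

/-- The initial configuration. -/
noncomputable def initialExec {n : ℕ} (P : Preferences n) (ident : Player n → ℕ) (ε : ℝ) :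
    Exec (Player n) PlayerState :=
  { state := fun v => PlayerState.init (numQuantiles ε) (gender v) ((P.list v).map ident) }

/-- The algorithm **ASM**`(P, ε, n)`, with `MM` as the subroutine for maximal matchings. -/
noncomputable def asm (MM : MatchingAlgorithm) {n : ℕ} (P : Preferences n) (ident : Player n → ℕ)
    (ε : ℝ) : Exec (Player n) PlayerState :=
  (List.range (Nat.log 2 n + 1)).foldl
    (fun e i =>
      (quantileMatch MM (numQuantiles ε) P.graph ident)^[numInner ε] (e.compute (testActive i)))
    (initialExec P ident ε)

end AlmostStable

/-!
The work lies in the subroutine: a deterministic maximal matching algorithm for two-coloured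
networks with `O(log⁴ n)` rounds and messages of `O(log n)` bits. The counts for ASM follow from its
running time by bookkeeping (`counts_asm`), with one point that needs care: for large `ε` there is
only one quantile, but then either `ε ≤ 16` or the inner loop is empty (`numQuantiles_le`).

*Removing a constant fraction of the edges.* The algorithm repeats an iteration `O(log n)` times. At
the start of an iteration every processor announces its degree in the graph of the edges between
unmatched processors. In a phase, the processors of one gender propose along edges towards
neighbours of no larger degree, and their proposals are weighted by their degrees `D`. A proposer
first spreads its choice, giving the share `1 / (4 D)` (up to a factor of two) to each possible
target, so that the demand at every target is at most `1 / 4`. Then the choices are rounded to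
integral ones. Suppose that this nearly preserves the utility `∑ D · share` less the price
`min (D u) (D v)` of every pair `u, v` that chooses the same target. If every target accepts the
heaviest proposal, the degrees of the accepted proposers add up to at least this objective
(`objective_le_of_integral`), hence to a constant fraction of the number of edges along which a
proposal was possible (`Proposed.gain`). As proposers are not adjacent to each other, this is the
number of edges that they remove. Every edge is directed towards the smaller degree in one of two
phases, one for each gender, and because both of them use the same degrees, together they remove a
constant fraction of the edges (`liveEdges_two_phases`).

*Rounding.* Proposers keep lists of `2 ^ K` labels, `K = O(log n)`, in which a target occurs in
proportion to its share. In each of `K` steps everyone keeps one half of the list and doubles the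
shares. A random half would preserve the objective in expectation, because it is linear in the choice
of each proposer. The method of conditional expectations applies if proposers in conflict do not
choose simultaneously: they are coloured, and colour classes choose one after another, each proposer
taking the half of larger value (`objective_update`, `Halving.classOps`). A proper colouring would
need too many colours; it is enough that only a fraction `1 / (3 K)` of the conflicts is
monochromatic, since these are multiplied by at most four, so that all `K` steps together multiply
the conflicts by a constant (`stepOps_spec`).

*Colouring.* Processors encode their colours by Reed-Solomon codes with `q` positions and `q`
symbols (`exists_code`). Everyone chooses the position at which the conflicts with processors of the
same symbol are least, and takes position and symbol as the new colour. Since two codewords agree in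
few positions, few conflicts become monochromatic on average over the positions, and so for the best
one (`monoCost_recolor_le`). Starting from the identifiers, this is done with `q = O(log² n)` and then
with `q = O(log n)`, so that `O(log² n)` colours remain. Colouring and the passage through the
colour classes take `O(log² n)` rounds in each of the `O(log² n)` halving steps.
-/

namespace AlmostStable

/-! ### Messages of fixed length -/

/-- The `L` lowest binary digits of `x`, the least significant digit first. -/
def encodeNat : ℕ → ℕ → Message
  | 0, _ => []
  | L + 1, x => decide (x % 2 = 1) :: encodeNat L (x / 2)

/-- The number with the given binary digits, the least significant digit first. -/
def decodeNat : Message → ℕ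
  | [] => 0
  | b :: l => (if b then 1 else 0) + 2 * decodeNat l

theorem length_encodeNat (L x : ℕ) : (encodeNat L x).length = L := by
  induction L generalizing x with
  | zero => rfl
  | succ L ih => simp [encodeNat, ih]

theorem decodeNat_encodeNat (L x : ℕ) : decodeNat (encodeNat L x) = x % 2 ^ L := by
  induction L generalizing x with
  | zero => simp [encodeNat, decodeNat, Nat.mod_one]
  | succ L ih =>
    have h : x % 2 ^ (L + 1) = x % 2 + 2 * (x / 2 % 2 ^ L) := by
      rw [pow_succ', Nat.mod_mul]
    rw [encodeNat, decodeNat, ih, h]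
    rcases Nat.mod_two_eq_zero_or_one x with h2 | h2 <;> simp [h2]

/-! ### Programs -/

/-- The messages that are waiting to be processed: sender and index of the message give its
value. -/
abbrev Buffer : Type := ℕ → ℕ → ℕ

/-- An exchange of vectors of numbers between neighbours, followed by a local computation. A
processor in state `s` sends the numbers `send s j i`, for `i < width`, to its neighbour with
identifier `j`. -/
structure Op (S : Type) where
  width : ℕ
  send : S → ℕ → ℕ → ℕ
  recv : S → Buffer → S

/-- The instructions of which a program consists; each of them takes one round. `fill op i` sends
the `i`-th entries of the vectors that belong to `op`, and `flush op` is the local computation that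
follows the last of them. -/
inductive Instr (S : Type) where
  | fill (op : Op S) (i : ℕ)
  | flush (op : Op S)

/-- What is sent in a round in which a given instruction is carried out; numbers are sent
modulo `2 ^ L`. -/
def Instr.send {S : Type} (L : ℕ) : Instr S → S × Buffer → ℕ → Option Message
  | fill op i, s, j => some (encodeNat L (op.send s.1 j i))
  | flush _, _, _ => none

/-- The update of the memory and the buffer in a round in which a given instruction is carried
out. -/
def Instr.receive {S : Type} : Instr S → S × Buffer → Inbox → S × Buffer
  | fill _ i, s, inb =>
      (s.1, fun j i' => if i' = i then (inb j).elim 0 decodeNat else s.2 j i')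
  | flush op, s, _ => (op.recv s.1 s.2, fun _ _ => 0)

theorem Instr.messageBits_send_le {S : Type} (L : ℕ) (m : Instr S) (s : S × Buffer) (j : ℕ) :
    messageBits (m.send L s j) ≤ L := by
  cases m <;> simp [Instr.send, messageBits, length_encodeNat]

/-- An exchange takes a round for each entry of the vectors and a silent round for the local
computation. -/
def Op.instrs {S : Type} (op : Op S) : List (Instr S) :=
  (List.range op.width).map (Instr.fill op) ++ [Instr.flush op]

theorem Op.length_instrs {S : Type} (op : Op S) : op.instrs.length = op.width + 1 := by
  simp [Op.instrs]

/-- The number of rounds that a program takes. -/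
def opsTime {S : Type} (ops : List (Op S)) : ℕ := (ops.map fun op => op.width + 1).sum

theorem length_flatMap_instrs {S : Type} (ops : List (Op S)) :
    (ops.flatMap Op.instrs).length = opsTime ops := by
  simp [List.length_flatMap, opsTime, Op.length_instrs]

theorem opsTime_append {S : Type} (l l' : List (Op S)) :
    opsTime (l ++ l') = opsTime l + opsTime l' := by
  simp [opsTime]

theorem opsTime_cons {S : Type} (a : Op S) (l : List (Op S)) :
    opsTime (a :: l) = a.width + 1 + opsTime l := by
  simp [opsTime]

theorem opsTime_nil {S : Type} : opsTime ([] : List (Op S)) = 0 := rfl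

theorem opsTime_flatMap {S : Type} (n b : ℕ) (f : ℕ → List (Op S))
    (h : ∀ t, opsTime (f t) = b) : opsTime ((List.range n).flatMap f) = n * b := by
  induction n with
  | zero => simp [opsTime]
  | succ n ih => simp [List.range_succ, opsTime_append, ih, h, Nat.succ_mul]

section Semantics

variable {V S : Type}

/-- The numbers that `v` receives when each `u` sends `f u j` to its neighbour with
identifier `j`. -/
noncomputable def received (G : SimpleGraph V) (ident : V → ℕ) (L : ℕ) (f : V → ℕ → ℕ) (v : V)
    (j : ℕ) : ℕ :=
  (inbox G ident (fun u k => some (encodeNat L (f u k))) v j).elim 0 decodeNat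

open Classical in
theorem received_ident (G : SimpleGraph V) {ident : V → ℕ} (hid : Function.Injective ident)
    (L : ℕ) (f : V → ℕ → ℕ) (v u : V) :
    received G ident L f v (ident u) = if G.Adj v u then f u (ident v) % 2 ^ L else 0 := by
  unfold received inbox
  by_cases h : G.Adj v u
  · have hex : ∃ u', G.Adj v u' ∧ ident u' = ident u := ⟨u, h, rfl⟩
    have hc : hex.choose = u := hid hex.choose_spec.2
    rw [dif_pos hex, hc, if_pos h]
    simp [decodeNat_encodeNat]
  · have hex : ¬ ∃ u', G.Adj v u' ∧ ident u' = ident u := by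
      rintro ⟨u', h1, h2⟩
      exact h (hid h2 ▸ h1)
    rw [dif_neg hex, if_neg h]
    rfl

/-- The effect of an exchange on the states of all processors. -/
noncomputable def Op.apply (G : SimpleGraph V) (ident : V → ℕ) (L : ℕ) (op : Op S) (st : V → S) :
    V → S :=
  fun v => op.recv (st v) fun j i =>
    if i < op.width then received G ident L (fun u k => op.send (st u) k i) v j else 0

/-- The effect of a program on the states of all processors. -/
noncomputable def runOps (G : SimpleGraph V) (ident : V → ℕ) (L : ℕ) (ops : List (Op S))
    (st : V → S) : V → S :=
  ops.foldl (fun st op => op.apply G ident L st) st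

theorem runOps_nil (G : SimpleGraph V) (ident : V → ℕ) (L : ℕ) (st : V → S) :
    runOps G ident L [] st = st := rfl

theorem runOps_cons (G : SimpleGraph V) (ident : V → ℕ) (L : ℕ) (op : Op S) (ops : List (Op S))
    (st : V → S) :
    runOps G ident L (op :: ops) st = runOps G ident L ops (op.apply G ident L st) := rfl

theorem runOps_append (G : SimpleGraph V) (ident : V → ℕ) (L : ℕ) (l l' : List (Op S))
    (st : V → S) :
    runOps G ident L (l ++ l') st = runOps G ident L l' (runOps G ident L l st) := by
  simp [runOps]

theorem runOps_flatMap_succ (G : SimpleGraph V) (ident : V → ℕ) (L : ℕ) (f : ℕ → List (Op S))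
    (n : ℕ) (st : V → S) :
    runOps G ident L ((List.range (n + 1)).flatMap f) st =
      runOps G ident L (f n) (runOps G ident L ((List.range n).flatMap f) st) := by
  simp [List.range_succ, runOps_append]

/-- The effect of an instruction on the states and buffers of all processors. -/
noncomputable def Instr.apply (G : SimpleGraph V) (ident : V → ℕ) (L : ℕ) (m : Instr S)
    (st : V → S × Buffer) : V → S × Buffer :=
  fun v => m.receive (st v) (inbox G ident (fun u => m.send L (st u)) v)

theorem foldl_fill (G : SimpleGraph V) (ident : V → ℕ) (L : ℕ) (op : Op S) (st : V → S) (k : ℕ) :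
    ((List.range k).map (Instr.fill op)).foldl (fun st m => Instr.apply G ident L m st)
        (fun v => (st v, fun _ _ => 0)) =
      fun v => (st v, fun j i =>
        if i < k then received G ident L (fun u k => op.send (st u) k i) v j else 0) := by
  induction k with
  | zero => simp
  | succ k ih =>
    rw [List.range_succ, List.map_append, List.foldl_append, ih]
    funext v
    simp only [List.map_cons, List.map_nil, List.foldl_cons, List.foldl_nil, Instr.apply,
      Instr.receive]
    congr 1
    funext j i
    by_cases h : i = k
    · subst h
      simp only [received, if_true, Nat.lt_succ_self]
      rfl
    · have : i < k + 1 ↔ i < k := by omega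
      simp [h, this]

/-- Carrying out the instructions of a program has the effect of the program and leaves the buffers
empty. -/
theorem foldl_instrs (G : SimpleGraph V) (ident : V → ℕ) (L : ℕ) (ops : List (Op S))
    (st : V → S) :
    (ops.flatMap Op.instrs).foldl (fun st m => Instr.apply G ident L m st)
        (fun v => (st v, fun _ _ => 0)) =
      fun v => (runOps G ident L ops st v, fun _ _ => 0) := by
  induction ops generalizing st with
  | nil => rfl
  | cons op ops ih =>
    rw [List.flatMap_cons, List.foldl_append, Op.instrs, List.foldl_append, foldl_fill]
    exact ih (op.apply G ident L st)

/-- The state of a processor that runs a program. -/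
structure ProgState (S : Type) where
  /-- the number of bits in a message -/
  len : ℕ
  /-- the remaining instructions -/
  prog : List (Instr S)
  /-- the memory proper, and the messages that wait to be processed -/
  mem : S × Buffer

/-- A processor whose program has ended sends nothing. -/
def progSend (s : ProgState S) (j : ℕ) : Option Message :=
  match s.prog with
  | [] => none
  | m :: _ => m.send s.len s.mem j

def progReceive (s : ProgState S) (inb : Inbox) : ProgState S :=
  match s.prog with
  | [] => s
  | m :: ms => { s with prog := ms, mem := m.receive s.mem inb }

/-- Running the network until the programs end is the same as folding the instructions over the
global memory. -/
theorem communicate_prog [Fintype V] (G : SimpleGraph V) (ident : V → ℕ) (L : ℕ)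
    (ms : List (Instr S)) (e : Exec V (ProgState S)) (st : V → S × Buffer)
    (he : e.state = fun v => ⟨L, ms, st v⟩) (hb : e.bits ≤ L) :
    ((Exec.communicate G ident progSend progReceive)^[ms.length] e).state =
        (fun v => ⟨L, [], ms.foldl (fun st m => Instr.apply G ident L m st) st v⟩) ∧
      ((Exec.communicate G ident progSend progReceive)^[ms.length] e).rounds =
        e.rounds + ms.length ∧
      ((Exec.communicate G ident progSend progReceive)^[ms.length] e).bits ≤ L := by
  induction ms generalizing e st with
  | nil => exact ⟨he, rfl, hb⟩
  | cons m ms ih =>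
    rw [List.length_cons, Function.iterate_succ_apply]
    have h := ih (Exec.communicate G ident progSend progReceive e) (Instr.apply G ident L m st)
      (by
        simp only [Exec.communicate, he]
        rfl)
      (by
        simp only [Exec.communicate, he]
        refine max_le hb (Finset.sup_le fun v _ => Finset.sup_le fun u _ => ?_)
        split_ifs
        · exact Instr.messageBits_send_le L m _ _
        · exact Nat.zero_le _)
    refine ⟨h.1, ?_, h.2.2⟩
    rw [h.2.1]
    simp only [Exec.communicate]
    omega

end Semantics

/-- The matching algorithm given by programs and message lengths that depend on the size of the
network. -/
def programAlgorithm {S : Type} (init : Gender → ℕ → Finset ℕ → S) (output : S → Option ℕ)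
    (len : ℕ → ℕ) (prog : ℕ → List (Op S)) : MatchingAlgorithm where
  State := ProgState S
  init n g i nbrs := ⟨len n, (prog n).flatMap Op.instrs, init g i nbrs, fun _ _ => 0⟩
  send := progSend
  receive := progReceive
  output s := output s.mem.1
  time n := opsTime (prog n)

open Classical in
theorem programAlgorithm_run {S : Type} (init : Gender → ℕ → Finset ℕ → S)
    (output : S → Option ℕ) (len : ℕ → ℕ) (prog : ℕ → List (Op S)) {n : ℕ}
    (G : SimpleGraph (Player n)) (ident : Player n → ℕ) :
    (∀ v, (programAlgorithm init output len prog).output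
        (((programAlgorithm init output len prog).run G ident).state v) =
      output (runOps G ident (len n) (prog n) (fun v => init (gender v) (ident v)
        ((Finset.univ.filter (G.Adj v)).image ident)) v)) ∧
    ((programAlgorithm init output len prog).run G ident).rounds = opsTime (prog n) ∧
    ((programAlgorithm init output len prog).run G ident).bits ≤ len n := by
  have h := communicate_prog G ident (len n) ((prog n).flatMap Op.instrs)
    { state := fun v => (programAlgorithm init output len prog).init n (gender v) (ident v)
        ((Finset.univ.filter (G.Adj v)).image ident) }
    (fun v => (init (gender v) (ident v) ((Finset.univ.filter (G.Adj v)).image ident),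
      fun _ _ => 0)) rfl (Nat.zero_le _)
  rw [length_flatMap_instrs, foldl_instrs] at h
  refine ⟨fun v => ?_, ?_, h.2.2⟩
  · exact congrArg (fun st => output (st v).mem.1) h.1
  · exact h.2.1.trans (Nat.zero_add _)

/-! ### Conflicts between fractional choices -/

open Classical in
/-- In a set of proposers, the total weight less the smaller weight of each pair is at most the
largest weight. -/
theorem sum_sub_pairs_le_max {V : Type} (s : Finset V) (D : V → ℝ) (hD : ∀ v, 0 ≤ D v)
    (b : V) (hb : b ∈ s) (hmax : ∀ v ∈ s, D v ≤ D b) :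
    ∑ v ∈ s, D v - 1 / 2 * ∑ u ∈ s, ∑ v ∈ s, (if u ≠ v then min (D u) (D v) else 0) ≤ D b := by
  have h1 : ∑ v ∈ s, D v = D b + ∑ v ∈ s.erase b, D v := (Finset.add_sum_erase s D hb).symm
  have h2 : 2 * ∑ v ∈ s.erase b, D v ≤
      ∑ u ∈ s, ∑ v ∈ s, (if u ≠ v then min (D u) (D v) else 0) := by
    rw [← Finset.add_sum_erase s _ hb, two_mul]
    refine add_le_add ?_ ?_
    · rw [← Finset.add_sum_erase s _ hb]
      simp only [ne_eq, not_true_eq_false, if_false, zero_add]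
      refine Finset.sum_le_sum fun v hv => ?_
      rw [if_pos (Finset.ne_of_mem_erase hv).symm,
        min_eq_right (hmax v (Finset.mem_of_mem_erase hv))]
    · refine Finset.sum_le_sum fun u hu => ?_
      calc D u = if u ≠ b then min (D u) (D b) else 0 := by
            rw [if_pos (Finset.ne_of_mem_erase hu),
              min_eq_left (hmax u (Finset.mem_of_mem_erase hu))]
        _ ≤ _ := Finset.single_le_sum (f := fun v => if u ≠ v then min (D u) (D v) else 0)
            (fun v _ => by
              split_ifs
              exacts [le_min (hD u) (hD v), le_rfl]) hb
  linarith

section Conflict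

variable {V : Type} [Fintype V]

/-- `y u w` is the share of its choice that `u` gives to `w`; `u` and `v` are in conflict as far as
they choose the same `w`, and `m u v` is the price. -/
def conflict (m y : V → V → ℝ) (u v : V) : ℝ := m u v * ∑ w, y u w * y v w

open Classical in
/-- The conflicts between pairs in a relation `r`. -/
noncomputable def costOn (r : V → V → Prop) (m y : V → V → ℝ) : ℝ :=
  ∑ u, ∑ v, if r u v then conflict m y u v else 0

/-- The total of all conflicts; every pair is counted twice. -/
noncomputable def cost (m y : V → V → ℝ) : ℝ := costOn (fun u v => u ≠ v) m y

/-- The conflicts between vertices of the same colour. -/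
noncomputable def monoCost (col : V → ℕ) (m y : V → V → ℝ) : ℝ :=
  costOn (fun u v => u ≠ v ∧ col u = col v) m y

/-- The conflicts between vertices of different colours. -/
noncomputable def biCost (col : V → ℕ) (m y : V → V → ℝ) : ℝ :=
  costOn (fun u v => col u ≠ col v) m y

/-- The weight of the choices: `a v` is what a choice of `v` is worth. -/
def utility (a : V → ℝ) (y : V → V → ℝ) : ℝ := ∑ v, ∑ w, a v * y v w

theorem conflict_nonneg {m y : V → V → ℝ} (hm : ∀ u v, 0 ≤ m u v) (hy : ∀ u v, 0 ≤ y u v)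
    (u v : V) : 0 ≤ conflict m y u v :=
  mul_nonneg (hm u v) (Finset.sum_nonneg fun w _ => mul_nonneg (hy u w) (hy v w))

theorem costOn_nonneg (r : V → V → Prop) {m y : V → V → ℝ} (hm : ∀ u v, 0 ≤ m u v)
    (hy : ∀ u v, 0 ≤ y u v) : 0 ≤ costOn r m y := by
  refine Finset.sum_nonneg fun u _ => Finset.sum_nonneg fun v _ => ?_
  split_ifs
  exacts [conflict_nonneg hm hy u v, le_rfl]

theorem cost_eq (col : V → ℕ) (m y : V → V → ℝ) :
    cost m y = monoCost col m y + biCost col m y := by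
  simp only [cost, monoCost, biCost, costOn, ← Finset.sum_add_distrib]
  refine Finset.sum_congr rfl fun u _ => Finset.sum_congr rfl fun v _ => ?_
  by_cases h : u = v
  · simp [h]
  · by_cases h' : col u = col v <;> simp [h, h']

/-- Doubling the shares multiplies conflicts by at most four. -/
theorem costOn_le_four_mul (r : V → V → Prop) {m y y' : V → V → ℝ} (hm : ∀ u v, 0 ≤ m u v)
    (hy' : ∀ u v, 0 ≤ y' u v) (h : ∀ u v, y' u v ≤ 2 * y u v) :
    costOn r m y' ≤ 4 * costOn r m y := by
  simp only [costOn, Finset.mul_sum]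
  refine Finset.sum_le_sum fun u _ => Finset.sum_le_sum fun v _ => ?_
  split_ifs
  · unfold conflict
    have : ∑ w, y' u w * y' v w ≤ 4 * ∑ w, y u w * y v w := by
      rw [Finset.mul_sum]
      refine Finset.sum_le_sum fun w _ => ?_
      calc y' u w * y' v w ≤ (2 * y u w) * (2 * y v w) :=
            mul_le_mul (h u w) (h v w) (hy' v w) ((hy' u w).trans (h u w))
        _ = 4 * (y u w * y v w) := by ring
    calc m u v * ∑ w, y' u w * y' v w ≤ m u v * (4 * ∑ w, y u w * y v w) :=
          mul_le_mul_of_nonneg_left this (hm u v)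
      _ = _ := by ring
  · simp

open Classical in
/-- If every vertex evaluates its codeword at a position at which the conflict with the vertices of
the same symbol is least, and takes position and symbol as its new colour, then few conflicts
become monochromatic, since two codewords agree in at most `d` of the `q` positions and the least
conflict is at most the average. -/
theorem monoCost_recolor_le {q d : ℕ} (hq : 0 < q) (code : ℕ → ℕ → ℕ) (col pos : V → ℕ)
    {m y : V → V → ℝ} (hm : ∀ u v, 0 ≤ m u v) (hy : ∀ u v, 0 ≤ y u v)
    (hcode : ∀ v, ∀ α < q, code (col v) α < q)
    (hagree : ∀ u v, col u ≠ col v →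
      ((Finset.range q).filter fun α => code (col u) α = code (col v) α).card ≤ d)
    (hpos : ∀ v, pos v < q)
    (hmin : ∀ v, ∀ β < q,
      (∑ u, if col u ≠ col v ∧ code (col u) (pos v) = code (col v) (pos v)
        then conflict m y v u else 0) ≤
      ∑ u, if col u ≠ col v ∧ code (col u) β = code (col v) β then conflict m y v u else 0) :
    monoCost (fun v => pos v * q + code (col v) (pos v)) m y ≤
      monoCost col m y + d / q * cost m y := by
  have hq' : (0 : ℝ) < q := by exact_mod_cast hq
  -- The minimum over all positions is at most the average.
  have key : ∀ v, (∑ u, if col u ≠ col v ∧ code (col u) (pos v) = code (col v) (pos v)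
      then conflict m y v u else 0) ≤ d / q * ∑ u, if v ≠ u then conflict m y v u else 0 := by
    intro v
    rw [div_mul_eq_mul_div, le_div_iff₀ hq', mul_comm]
    calc (q : ℝ) * _ = ∑ _β ∈ Finset.range q, ∑ u,
          (if col u ≠ col v ∧ code (col u) (pos v) = code (col v) (pos v)
            then conflict m y v u else 0) := by simp
      _ ≤ ∑ β ∈ Finset.range q, ∑ u,
          (if col u ≠ col v ∧ code (col u) β = code (col v) β
            then conflict m y v u else 0) :=
          Finset.sum_le_sum fun β hβ => hmin v β (Finset.mem_range.1 hβ)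
      _ = ∑ u, ∑ β ∈ Finset.range q, (if col u ≠ col v ∧ code (col u) β = code (col v) β
            then conflict m y v u else 0) := Finset.sum_comm
      _ ≤ ∑ u, d * (if v ≠ u then conflict m y v u else 0) := by
          refine Finset.sum_le_sum fun u _ => ?_
          by_cases hc : col u = col v
          · simp only [hc, ne_eq, not_true_eq_false, false_and, if_false, Finset.sum_const_zero]
            split_ifs
            · exact le_of_eq (by simp)
            · exact mul_nonneg (Nat.cast_nonneg d) (conflict_nonneg hm hy v u)
          · have hne : v ≠ u := fun h => hc (h ▸ rfl)
            simp only [ne_eq, hc, not_false_eq_true, true_and, hne, if_true]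
            rw [← Finset.sum_filter, Finset.sum_const, nsmul_eq_mul]
            exact mul_le_mul_of_nonneg_right (by exact_mod_cast hagree u v hc)
              (conflict_nonneg hm hy v u)
      _ = _ := by rw [Finset.mul_sum]
  calc monoCost (fun v => pos v * q + code (col v) (pos v)) m y
      ≤ monoCost col m y + ∑ v, ∑ u,
          (if col u ≠ col v ∧ code (col u) (pos v) = code (col v) (pos v)
            then conflict m y v u else 0) := by
        simp only [monoCost, costOn, ← Finset.sum_add_distrib]
        refine Finset.sum_le_sum fun u _ => Finset.sum_le_sum fun v _ => ?_
        have hc := conflict_nonneg hm hy u v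
        by_cases h : u ≠ v ∧ pos u * q + code (col u) (pos u) = pos v * q + code (col v) (pos v)
        · rw [if_pos h]
          have hp : pos u = pos v := by
            have h1 := congrArg (· / q) h.2
            simpa [Nat.add_div_of_dvd_right (dvd_mul_left q _), Nat.mul_div_cancel _ hq,
              Nat.div_eq_of_lt (hcode u _ (hpos u)), Nat.div_eq_of_lt (hcode v _ (hpos v))]
              using h1
          have hs : code (col v) (pos u) = code (col u) (pos u) := by
            have h2 := h.2
            rw [hp] at h2 ⊢
            omega
          by_cases hcol : col u = col v
          · rw [if_pos ⟨h.1, hcol⟩]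
            refine le_add_of_nonneg_right ?_
            split_ifs
            exacts [hc, le_rfl]
          · rw [if_pos (show col v ≠ col u ∧ _ from ⟨Ne.symm hcol, hs⟩)]
            refine le_add_of_nonneg_left ?_
            split_ifs
            exacts [hc, le_rfl]
        · rw [if_neg h]
          refine add_nonneg ?_ ?_ <;> split_ifs <;> first | exact hc | exact le_rfl
    _ ≤ monoCost col m y + ∑ v, d / q * ∑ u, (if v ≠ u then conflict m y v u else 0) :=
        add_le_add le_rfl (Finset.sum_le_sum fun v _ => key v)
    _ = _ := by
        rw [← Finset.mul_sum, cost, costOn]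
        congr!

open Classical in
theorem monoCost_of_injective {col : V → ℕ} (h : Function.Injective col) (m y : V → V → ℝ) :
    monoCost col m y = 0 := by
  refine Finset.sum_eq_zero fun u _ => Finset.sum_eq_zero fun v _ => ?_
  rw [if_neg]
  exact fun h' => h'.1 (h h'.2)

open Classical in
/-- The price per unit of the share that `v` gives to `w`, as far as it comes from vertices of
other colours. -/
noncomputable def price (col : V → ℕ) (m y : V → V → ℝ) (v w : V) : ℝ :=
  ∑ u, if col u ≠ col v then m u v * y u w else 0

open Classical in
/-- The bichromatic conflicts of two families of shares, sorted by the vertex whose share changes. -/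
theorem biCost_eq_sum_price (col : V → ℕ) (m y z : V → V → ℝ) (hm : ∀ u v, m u v = m v u) :
    (∑ u, ∑ v, if col u ≠ col v then m u v * ∑ w, z u w * y v w else 0) =
      ∑ v, ∑ w, z v w * price col m y v w := by
  refine Finset.sum_congr rfl fun v _ => ?_
  simp only [price, Finset.mul_sum]
  rw [Finset.sum_comm]
  refine Finset.sum_congr rfl fun u _ => ?_
  by_cases h : col u = col v
  · simp [h]
  · simp only [ne_eq, h, Ne.symm h, not_false_eq_true, if_true]
    refine Finset.sum_congr rfl fun w _ => ?_
    rw [hm u v]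
    ring

open Classical in
/-- When only the choices in one colour class change, the bichromatic objective changes by a linear
function of the change, because the members of the class are not in bichromatic conflict with each
other. -/
theorem objective_update (col : V → ℕ) (κ : ℕ) (a : V → ℝ) (m y y' : V → V → ℝ) (l : ℝ)
    (hm : ∀ u v, m u v = m v u) (hκ : ∀ v, col v ≠ κ → y' v = y v) :
    utility a y' - l / 2 * biCost col m y' = utility a y - l / 2 * biCost col m y +
      ∑ v, if col v = κ then ∑ w, (y' v w - y v w) * (a v - l * price col m y v w) else 0 := by
  set z : V → V → ℝ := fun v w => y' v w - y v w with hz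
  have hz0 : ∀ v, col v ≠ κ → ∀ w, z v w = 0 := fun v hv w => by simp [hz, hκ v hv]
  have hy' : ∀ v w, y' v w = y v w + z v w := fun v w => by simp [hz]
  have hbi : biCost col m y' = biCost col m y + 2 * ∑ v, ∑ w, z v w * price col m y v w := by
    have h1 := biCost_eq_sum_price col m y z hm
    have h2 : (∑ u, ∑ v, if col u ≠ col v then m u v * ∑ w, y u w * z v w else 0) =
        ∑ v, ∑ w, z v w * price col m y v w := by
      rw [← h1, Finset.sum_comm]
      refine Finset.sum_congr rfl fun u _ => Finset.sum_congr rfl fun v _ => ?_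
      simp only [ne_eq, eq_comm (a := col u), hm u v, mul_comm (z u _)]
    rw [two_mul]
    nth_rewrite 1 [← h1]
    rw [← h2]
    simp only [biCost, costOn, conflict, ← Finset.sum_add_distrib]
    refine Finset.sum_congr rfl fun u _ => Finset.sum_congr rfl fun v _ => ?_
    by_cases h : col u = col v
    · simp [h]
    · simp only [ne_eq, h, not_false_eq_true, if_true, ← mul_add, ← Finset.sum_add_distrib]
      congr 1
      refine Finset.sum_congr rfl fun w _ => ?_
      -- Vertices of different colours do not change simultaneously.
      have : z u w * z v w = 0 := by
        by_cases hu : col u = κ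
        · rw [hz0 v (fun hv => h (hu.trans hv.symm)), mul_zero]
        · rw [hz0 u hu, zero_mul]
      rw [hy' u, hy' v]
      linear_combination this
  have hsum : (∑ v, if col v = κ then ∑ w, (y' v w - y v w) * (a v - l * price col m y v w)
      else 0) = ∑ v, ∑ w, (a v * z v w - l * (z v w * price col m y v w)) := by
    refine Finset.sum_congr rfl fun v _ => ?_
    split_ifs with h
    · exact Finset.sum_congr rfl fun w _ => by simp only [hz]; ring
    · exact (Finset.sum_eq_zero fun w _ => by rw [hz0 v h w]; ring).symm
  have hu : utility a y' = utility a y + ∑ v, ∑ w, a v * z v w := by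
    simp only [utility, hy', mul_add, Finset.sum_add_distrib]
  rw [hsum, hbi, hu]
  simp only [Finset.sum_sub_distrib, ← Finset.mul_sum]
  ring

/-- If the demand at every `w` is at most `N / 4`, the conflicts cost at most a quarter of the
utility. -/
theorem cost_le_of_demand_le {N : ℝ} {D : V → ℝ} {y : V → V → ℝ}
    (hD : ∀ v, 0 ≤ D v) (hy : ∀ u v, 0 ≤ y u v) (hdem : ∀ w, ∑ u, y u w ≤ N / 4) :
    cost (fun u v => min (D u) (D v)) y ≤ utility (fun v => N * D v) y / 4 := by
  calc cost (fun u v => min (D u) (D v)) y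
      ≤ ∑ u, ∑ v, D u * ∑ w, y u w * y v w := by
        refine Finset.sum_le_sum fun u _ => Finset.sum_le_sum fun v _ => ?_
        have h0 : 0 ≤ ∑ w, y u w * y v w :=
          Finset.sum_nonneg fun w _ => mul_nonneg (hy u w) (hy v w)
        split_ifs
        · exact mul_le_mul_of_nonneg_right (min_le_left _ _) h0
        · exact mul_nonneg (hD u) h0
    _ = ∑ u, ∑ w, D u * y u w * ∑ v, y v w := by
        refine Finset.sum_congr rfl fun u _ => ?_
        simp only [Finset.mul_sum]
        rw [Finset.sum_comm]
        exact Finset.sum_congr rfl fun w _ => Finset.sum_congr rfl fun v _ => by ring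
    _ ≤ ∑ u, ∑ w, D u * y u w * (N / 4) :=
        Finset.sum_le_sum fun u _ => Finset.sum_le_sum fun w _ =>
          mul_le_mul_of_nonneg_left (hdem w) (mul_nonneg (hD u) (hy u w))
    _ = _ := by
        rw [utility, Finset.sum_div]
        refine Finset.sum_congr rfl fun u _ => ?_
        rw [Finset.sum_div]
        exact Finset.sum_congr rfl fun w _ => by ring

open Classical in
/-- When all choices are integral and each `w` that is chosen takes its heaviest proposer, the total
weight of these proposers is at least the value of the objective. -/
theorem objective_le_of_integral {N : ℝ} {D : V → ℝ} (hD : ∀ v, 0 ≤ D v) (r : V → V → Prop)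
    (y : V → V → ℝ) (hy : ∀ v w, y v w = if r v w then N else 0) (best : V → V)
    (hbest : ∀ w, (∃ v, r v w) → r (best w) w ∧ ∀ v, r v w → D v ≤ D (best w)) :
    utility (fun v => N * D v) y - 1 / 2 * cost (fun u v => min (D u) (D v)) y ≤
      N ^ 2 * ∑ w, if ∃ v, r v w then D (best w) else 0 := by
  have hu : utility (fun v => N * D v) y =
      ∑ w, N ^ 2 * ∑ v ∈ Finset.univ.filter (fun v => r v w), D v := by
    rw [utility, Finset.sum_comm]
    refine Finset.sum_congr rfl fun w _ => ?_
    rw [Finset.mul_sum, Finset.sum_filter]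
    refine Finset.sum_congr rfl fun v _ => ?_
    rw [hy]
    split_ifs <;> ring
  have hc : cost (fun u v => min (D u) (D v)) y =
      ∑ w, N ^ 2 * ∑ u ∈ Finset.univ.filter (fun v => r v w),
        ∑ v ∈ Finset.univ.filter (fun v => r v w),
          (if u ≠ v then min (D u) (D v) else 0) := by
    calc cost (fun u v => min (D u) (D v)) y
        = ∑ u, ∑ v, ∑ w, (if u ≠ v then min (D u) (D v) else 0) * (y u w * y v w) := by
          refine Finset.sum_congr rfl fun u _ => Finset.sum_congr rfl fun v _ => ?_
          rw [← Finset.mul_sum]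
          split_ifs <;> simp [conflict]
      _ = ∑ w, ∑ u, ∑ v, (if u ≠ v then min (D u) (D v) else 0) * (y u w * y v w) := by
          rw [Finset.sum_comm]
          rw [Finset.sum_congr rfl fun v _ => Finset.sum_comm]
          rw [Finset.sum_comm]
          exact Finset.sum_congr rfl fun w _ => Finset.sum_comm
      _ = _ := by
          refine Finset.sum_congr rfl fun w _ => ?_
          rw [Finset.sum_filter, Finset.mul_sum]
          refine Finset.sum_congr rfl fun u _ => ?_
          rw [Finset.sum_filter]
          by_cases h : r u w
          · rw [if_pos h, Finset.mul_sum]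
            refine Finset.sum_congr rfl fun v _ => ?_
            rw [hy, hy, if_pos h]
            by_cases h' : r v w <;> simp only [h', if_true, if_false] <;> split_ifs <;> ring
          · rw [if_neg h, mul_zero]
            exact Finset.sum_eq_zero fun v _ => by rw [hy u, if_neg h]; ring
  rw [hu, hc, Finset.mul_sum, ← Finset.sum_sub_distrib, Finset.mul_sum]
  refine Finset.sum_le_sum fun w _ => ?_
  by_cases h : ∃ v, r v w
  · rw [if_pos h]
    have := sum_sub_pairs_le_max (Finset.univ.filter fun v => r v w) D hD (best w)
      (by simpa using (hbest w h).1) (fun v hv => (hbest w h).2 v (by simpa using hv))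
    have h2 := mul_le_mul_of_nonneg_left this (sq_nonneg N)
    linarith
  · rw [if_neg h]
    have : Finset.univ.filter (fun v => r v w) = ∅ := by
      refine Finset.filter_eq_empty_iff.2 fun v _ hv => h ⟨v, hv⟩
    simp [this]

end Conflict

/-! ### Codes -/

/-- Reed-Solomon codes: numbers below `M ≤ q ^ (d + 1)` are encoded by polynomials of degree at
most `d` over the field with `q` elements, and two such polynomials agree in at most `d` points. -/
theorem exists_code {q d M : ℕ} (hq : q.Prime) (hM : M ≤ q ^ (d + 1)) :
    ∃ code : ℕ → ℕ → ℕ, (∀ x α, code x α < q) ∧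
      ∀ x < M, ∀ x' < M, x ≠ x' →
        ((Finset.range q).filter fun α => code x α = code x' α).card ≤ d := by
  have : Fact q.Prime := ⟨hq⟩
  obtain ⟨f⟩ : Nonempty (Fin M ↪ (Fin (d + 1) → ZMod q)) := by
    refine Function.Embedding.nonempty_of_card_le ?_
    simpa [ZMod.card] using hM
  let p : ℕ → Polynomial (ZMod q) := fun x =>
    if h : x < M then ((Polynomial.degreeLTEquiv (ZMod q) (d + 1)).symm (f ⟨x, h⟩)).1 else 0
  have hdeg : ∀ x, p x ∈ Polynomial.degreeLT (ZMod q) (d + 1) := by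
    intro x
    by_cases h : x < M
    · simp only [p, dif_pos h]
      exact ((Polynomial.degreeLTEquiv (ZMod q) (d + 1)).symm (f ⟨x, h⟩)).2
    · simp only [p, dif_neg h]
      exact Submodule.zero_mem _
  have hinj : ∀ x < M, ∀ x' < M, p x = p x' → x = x' := by
    intro x hx x' hx' h
    simp only [p, dif_pos hx, dif_pos hx'] at h
    have h1 := f.injective ((Polynomial.degreeLTEquiv (ZMod q) (d + 1)).symm.injective
      (Subtype.ext h))
    exact congrArg Fin.val h1
  refine ⟨fun x α => ((p x).eval (α : ZMod q)).val, fun x α => ZMod.val_lt _, ?_⟩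
  intro x hx x' hx' hne
  set r := p x - p x' with hr
  have hr0 : r ≠ 0 := fun h => hne (hinj x hx x' hx' (sub_eq_zero.1 h))
  have hrd : r.natDegree ≤ d := by
    have := Submodule.sub_mem _ (hdeg x) (hdeg x')
    rw [Polynomial.mem_degreeLT] at this
    have h2 := (Polynomial.natDegree_lt_iff_degree_lt hr0).2 this
    omega
  calc ((Finset.range q).filter fun α : ℕ =>
        ((p x).eval (α : ZMod q)).val = ((p x').eval (α : ZMod q)).val).card
      ≤ r.roots.toFinset.card := by
        refine Finset.card_le_card_of_injOn (fun α : ℕ => (α : ZMod q)) ?_ ?_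
        · intro α hα
          have h := (Finset.mem_filter.1 (Finset.mem_coe.1 hα)).2
          have h' := ZMod.val_injective q h
          simp only [Finset.mem_coe, Multiset.mem_toFinset]
          rw [Polynomial.mem_roots hr0]
          simp [hr, h']
        · intro α hα β hβ h
          have hα' := Finset.mem_range.1 (Finset.mem_filter.1 (Finset.mem_coe.1 hα)).1
          have hβ' := Finset.mem_range.1 (Finset.mem_filter.1 (Finset.mem_coe.1 hβ)).1
          have := (ZMod.natCast_eq_natCast_iff' α β q).1 h
          rwa [Nat.mod_eq_of_lt hα', Nat.mod_eq_of_lt hβ'] at this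
    _ ≤ r.roots.card := Multiset.toFinset_card_le _
    _ ≤ r.natDegree := Polynomial.card_roots' r
    _ ≤ d := hrd

/-- The least position below `q` at which `f` attains its minimum. -/
noncomputable def argminBelow (q : ℕ) (f : ℕ → ℕ) : ℕ :=
  sInf {α | α < q ∧ ∀ β < q, f α ≤ f β}

theorem argminBelow_spec {q : ℕ} (hq : 0 < q) (f : ℕ → ℕ) :
    argminBelow q f < q ∧ ∀ β < q, f (argminBelow q f) ≤ f β := by
  have h : {α | α < q ∧ ∀ β < q, f α ≤ f β}.Nonempty := by
    obtain ⟨α, hα, hm⟩ := Finset.exists_min_image (Finset.range q) f ⟨0, Finset.mem_range.2 hq⟩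
    exact ⟨α, Finset.mem_range.1 hα, fun β hβ => hm β (Finset.mem_range.2 hβ)⟩
  exact Nat.sInf_mem h

/-! ### The matching program -/

/-- The memory of a processor that does not change while the choices of the proposers are being
rounded. -/
structure Base where
  gender : Gender
  ident : ℕ
  nbrs : Finset ℕ
  mate : Option ℕ
  /-- the neighbours to which a still unmatched processor can be matched -/
  live : Finset ℕ
  deg : ℕ
  nbrDeg : ℕ → ℕ

/-- The memory of a processor. A proposer holds a list of labels, in which `some j` stands for the
neighbour `j`. The list is halved in the course of the algorithm until a single label remains;
`scale` is the factor by which it has become shorter. -/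
structure Node where
  base : Base
  labels : List (Option ℕ)
  scale : ℕ
  color : ℕ
  nbrColor : ℕ → ℕ
  /-- what the neighbours have announced as the share that they give to this processor -/
  share : ℕ → ℕ

/-- The share of `j` in the choice of a proposer. -/
def Node.weight (s : Node) (j : ℕ) : ℕ := s.scale * s.labels.count (some j)

/-- The neighbours to which a processor may propose when the processors of gender `g` are the
proposers: those whose degree is not larger. -/
def Base.targets (g : Gender) (b : Base) : Finset ℕ :=
  if b.gender = g then b.live.filter fun j => b.nbrDeg j ≤ b.deg else ∅

/-- A list of `N` labels in which every target occurs `N / (4 deg)` times. -/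
def initialLabels (g : Gender) (N : ℕ) (b : Base) : List (Option ℕ) :=
  let l := (b.targets g).sort.flatMap fun j => List.replicate (N / (4 * b.deg)) (some j)
  l ++ List.replicate (N - l.length) none

/-- The price that a processor attaches to a conflict between two of its neighbours: the smaller of
their degrees. -/
def Base.pairWeight (b : Base) (i j : ℕ) : ℕ := min (b.nbrDeg i) (b.nbrDeg j)

/-- The memory at the start, when everyone is unmatched. -/
def initialNode (g : Gender) (i : ℕ) (nbrs : Finset ℕ) : Node where
  base := ⟨g, i, nbrs, none, nbrs, 0, fun _ => 0⟩
  labels := []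
  scale := 0
  color := 0
  nbrColor := fun _ => 0
  share := fun _ => 0

/-- Matched processors announce that they are matched. -/
def refreshOp : Op Node where
  width := 1
  send s _ _ := if s.base.mate.isSome then 1 else 0
  recv s buf :=
    { s with base := { s.base with
        live := if s.base.mate.isSome then ∅ else s.base.nbrs.filter fun j => buf j 0 = 0 } }

/-- Processors announce how many live neighbours they have. -/
def degreeOp : Op Node where
  width := 1
  send s _ _ := s.base.live.card
  recv s buf :=
    { s with base := { s.base with deg := s.base.live.card, nbrDeg := fun j => buf j 0 } }

/-- Proposers spread their choices over their targets; everyone else has only empty labels. -/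
def startOp (g : Gender) (N : ℕ) : Op Node where
  width := 0
  send _ _ _ := 0
  recv s _ := { s with labels := initialLabels g N s.base, scale := 1 }

/-- Identifiers serve as colours at first. -/
def resetColorOp : Op Node where
  width := 0
  send _ _ _ := 0
  recv s _ := { s with color := s.base.ident, nbrColor := fun j => j }

/-- Proposers announce the shares to their targets. -/
def shareOp : Op Node where
  width := 1
  send s j _ := s.weight j
  recv s buf := { s with share := fun j => buf j 0 }

/-- Processors announce their colours. -/
def colorOp : Op Node where
  width := 1
  send s _ _ := s.color
  recv s buf := { s with nbrColor := fun j => buf j 0 }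

/-- For each position of a code, a processor tells its neighbour `j` the conflicts of `j` with
those neighbours of other colours whose codewords have the same symbol as that of `j` at this
position. Then everyone chooses the best position. -/
noncomputable def recolorOp (q : ℕ) (code : ℕ → ℕ → ℕ) : Op Node where
  width := q
  send s j α := ∑ i ∈ s.base.nbrs,
    if s.nbrColor i ≠ s.nbrColor j ∧ code (s.nbrColor i) α = code (s.nbrColor j) α then
      s.base.pairWeight i j * (s.share j * s.share i) else 0
  recv s buf :=
    let α := argminBelow q fun α => ∑ j ∈ s.base.nbrs, buf j α
    { s with color := α * q + code s.color α }

/-- The value of a list of labels at prices `price`, when the labels have weight `scale`. -/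
noncomputable def labelsValue (N : ℕ) (l : ℝ) (b : Base) (price : ℕ → ℕ) (scale : ℕ)
    (labels : List (Option ℕ)) : ℝ :=
  ∑ j ∈ b.nbrs, ((scale * labels.count (some j) : ℕ) : ℝ) * (N * b.deg - l * price j)

open Classical in
/-- The better half of a list of labels. -/
noncomputable def betterHalf (N : ℕ) (l : ℝ) (b : Base) (price : ℕ → ℕ) (scale : ℕ)
    (labels : List (Option ℕ)) : List (Option ℕ) :=
  if labelsValue N l b price scale (labels.drop (labels.length / 2)) ≤
      labelsValue N l b price scale (labels.take (labels.length / 2)) then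
    labels.take (labels.length / 2)
  else labels.drop (labels.length / 2)

/-- The processors of colour `κ` learn the prices of their targets and keep the better half of
their labels. -/
noncomputable def halveOp (N κ : ℕ) (l : ℝ) : Op Node where
  width := 1
  send s j _ := ∑ i ∈ s.base.nbrs,
    if s.nbrColor i ≠ s.nbrColor j then s.base.pairWeight i j * s.share i else 0
  recv s buf :=
    if s.color = κ then
      { s with
        labels := betterHalf N l s.base (fun j => buf j 0) (2 * s.scale) s.labels
        scale := 2 * s.scale }
    else s

/-- The neighbours from which there is a proposal. -/
def Node.proposals (s : Node) : Finset ℕ := s.base.nbrs.filter fun j => 0 < s.share j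

open Classical in
/-- The proposal from a neighbour of largest degree. -/
noncomputable def Node.best (s : Node) : Option ℕ :=
  if h : s.proposals.Nonempty then
    some (s.proposals.exists_max_image s.base.nbrDeg h).choose
  else none

/-- The best proposals are accepted. -/
noncomputable def acceptOp : Op Node where
  width := 1
  send s j _ := if s.best = some j then 1 else 0
  recv s buf :=
    { s with base := { s.base with
        mate := s.best.or ((s.base.nbrs.filter fun j => buf j 0 = 1).sort.head?.or s.base.mate) } }

/-- The numbers that control the program. -/
structure Params where
  /-- the number of halvings -/
  K : ℕ
  q₁ : ℕ
  code₁ : ℕ → ℕ → ℕ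
  q₂ : ℕ
  code₂ : ℕ → ℕ → ℕ

/-- The factor that weighs conflicts against utility when `t` halvings have been done. -/
noncomputable def Params.factor (p : Params) (t : ℕ) : ℝ := (1 + 1 / (p.K : ℝ)) ^ (p.K - t)

/-- A defective colouring, in two levels, for the current conflicts. -/
noncomputable def Params.colorOps (p : Params) : List (Op Node) :=
  [resetColorOp, shareOp, recolorOp p.q₁ p.code₁, colorOp, recolorOp p.q₂ p.code₂, colorOp]

/-- The processors of colour `κ` halve their lists of labels. -/
noncomputable def Params.classOps (p : Params) (t κ : ℕ) : List (Op Node) :=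
  [shareOp, halveOp (2 ^ p.K) κ (p.factor (t + 1))]

/-- A halving step. -/
noncomputable def Params.stepOps (p : Params) (t : ℕ) : List (Op Node) :=
  p.colorOps ++ (List.range (p.q₂ * p.q₂)).flatMap (p.classOps t)

/-- The rounding of fractional to integral choices. -/
noncomputable def Params.roundingOps (p : Params) : List (Op Node) :=
  (List.range p.K).flatMap p.stepOps

/-- A phase in which the processors of gender `g` are the proposers. -/
noncomputable def Params.phaseOps (p : Params) (g : Gender) : List (Op Node) :=
  [startOp g (2 ^ p.K)] ++ p.roundingOps ++ [shareOp, acceptOp, refreshOp]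

/-- Two phases, one for each gender as proposers, with the same degrees. -/
noncomputable def Params.iterationOps (p : Params) : List (Op Node) :=
  [degreeOp] ++ p.phaseOps Gender.male ++ p.phaseOps Gender.female

/-- The complete program. The number of iterations is such that `(32 / 33) ^ (66 * K) ≤ 2 ^ (-2 * K)`,
where `2 ^ (2 * K)` exceeds the number of edges. -/
noncomputable def Params.ops (p : Params) : List (Op Node) :=
  (List.range (66 * p.K)).flatMap fun _ => p.iterationOps

theorem opsTime_ops (p : Params) :
    opsTime p.ops = 66 * p.K *
      (2 + 2 * (7 + p.K * (9 + p.q₁ + p.q₂ + p.q₂ * p.q₂ * 4))) := by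
  have h1 : ∀ t, opsTime (p.stepOps t) = 9 + p.q₁ + p.q₂ + p.q₂ * p.q₂ * 4 := by
    intro t
    rw [Params.stepOps, opsTime_append, opsTime_flatMap _ 4 (p.classOps t) (fun _ => rfl)]
    simp only [Params.colorOps, opsTime_cons, opsTime_nil, resetColorOp, shareOp, recolorOp,
      colorOp]
    ring
  have h2 : ∀ g, opsTime (p.phaseOps g) = 7 + p.K * (9 + p.q₁ + p.q₂ + p.q₂ * p.q₂ * 4) := by
    intro g
    rw [Params.phaseOps, opsTime_append, opsTime_append, Params.roundingOps,
      opsTime_flatMap _ _ _ h1]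
    simp only [opsTime_cons, opsTime_nil, startOp, shareOp, acceptOp, refreshOp]
    ring
  rw [Params.ops, opsTime_flatMap _ (opsTime p.iterationOps) _ (fun _ => rfl)]
  congr 1
  rw [Params.iterationOps, opsTime_append, opsTime_append, h2, h2]
  simp only [opsTime_cons, opsTime_nil, degreeOp]
  ring

/-! ### Rounding the choices of the proposers -/

section Rounding

variable {V : Type} {G : SimpleGraph V} {ident : V → ℕ} {p : Params} {L : ℕ}

/-- After `t` halvings the list of labels has length `2 ^ (K - t)` and contains only targets. -/
structure Level (g : Gender) (K t : ℕ) (s : Node) : Prop where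
  le : t ≤ K
  scale_eq : s.scale = 2 ^ t
  length_eq : s.labels.length = 2 ^ (K - t)
  support : ∀ j, some j ∈ s.labels → j ∈ s.base.targets g

theorem Base.targets_subset (g : Gender) (b : Base) : b.targets g ⊆ b.live := by
  unfold Base.targets
  split_ifs
  · exact Finset.filter_subset _ _
  · exact Finset.empty_subset _

theorem Level.weight_le {g : Gender} {K t : ℕ} {s : Node} (h : Level g K t s) (j : ℕ) :
    s.weight j ≤ 2 ^ K := by
  calc s.weight j ≤ s.scale * s.labels.length := Nat.mul_le_mul_left _ List.count_le_length
    _ = 2 ^ K := by rw [h.scale_eq, h.length_eq, ← pow_add, Nat.add_sub_cancel' h.le]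

theorem Level.weight_eq_zero {g : Gender} {K t : ℕ} {s : Node} (h : Level g K t s) {j : ℕ}
    (hj : j ∉ s.base.targets g) : s.weight j = 0 := by
  rw [Node.weight, List.count_eq_zero_of_not_mem (fun h' => hj (h.support j h')), mul_zero]

theorem received_of_adj (hid : Function.Injective ident) {f : V → ℕ → ℕ} {v u : V}
    (h : G.Adj v u) (hf : f u (ident v) < 2 ^ L) :
    received G ident L f v (ident u) = f u (ident v) := by
  rw [received_ident G hid, if_pos h, Nat.mod_eq_of_lt hf]

/-- Everyone knows the shares that are given to him. -/
def Shared (ident : V → ℕ) (st : V → Node) : Prop :=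
  ∀ u v, (st v).share (ident u) = (st u).weight (ident v)

/-- Everyone knows the colours of the neighbours. -/
def Colored (G : SimpleGraph V) (ident : V → ℕ) (st : V → Node) : Prop :=
  ∀ v u, G.Adj v u → (st v).nbrColor (ident u) = (st u).color

/-- The states between two exchanges of the rounding; not everyone's labels need be at the same
level. -/
structure Rounding (G : SimpleGraph V) (ident : V → ℕ) (p : Params) (g : Gender) (β : V → Base)
    (st : V → Node) : Prop where
  base_eq : ∀ v, (st v).base = β v
  level : ∀ v, ∃ t, Level g p.K t (st v)

theorem Rounding.weight_le {g : Gender} {β : V → Base} {st : V → Node}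
    (h : Rounding G ident p g β st) (v : V) (j : ℕ) : (st v).weight j ≤ 2 ^ p.K :=
  let ⟨_, ht⟩ := h.level v
  ht.weight_le j

/-- The degree of a processor, as a weight. -/
def degR (β : V → Base) (v : V) : ℝ := ((β v).deg : ℝ)

/-- The shares as real numbers. -/
def shares (ident : V → ℕ) (st : V → Node) (v w : V) : ℝ := ((st v).weight (ident w) : ℝ)

theorem shares_nonneg (ident : V → ℕ) (st : V → Node) (v w : V) : 0 ≤ shares ident st v w :=
  Nat.cast_nonneg _

/-- The price of a conflict. -/
def minDeg (β : V → Base) (u v : V) : ℝ := min (degR β u) (degR β v)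

theorem minDeg_nonneg (β : V → Base) (u v : V) : 0 ≤ minDeg β u v :=
  le_min (Nat.cast_nonneg _) (Nat.cast_nonneg _)

theorem minDeg_comm (β : V → Base) (u v : V) : minDeg β u v = minDeg β v u := min_comm _ _

theorem colored_colorOp (hid : Function.Injective ident) {st : V → Node}
    (hcol : ∀ v, (st v).color < 2 ^ L) : Colored G ident (colorOp.apply G ident L st) := by
  intro v u hvu
  change (if 0 < 1 then received G ident L (fun u _ => (st u).color) v (ident u) else 0) =
    (st u).color
  rw [if_pos one_pos]
  exact received_of_adj hid hvu (hcol u)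

variable [Fintype V]

/-- The network is small enough for `K` halvings and for messages of `L` bits, and the codes have so
few agreements that at most one conflict in `6 K` becomes monochromatic in each level of the
colouring. -/
structure Setting (ident : V → ℕ) (p : Params) (L : ℕ) : Prop where
  inj : Function.Injective ident
  K_pos : 0 < p.K
  card_le : 4 * Fintype.card V ≤ 2 ^ p.K
  len : 4 * p.K < L
  q₁_pos : 0 < p.q₁
  q₂_pos : 0 < p.q₂
  q₁_len : p.q₁ * p.q₁ ≤ 2 ^ L
  q₂_len : p.q₂ * p.q₂ ≤ 2 ^ L
  code₁_lt : ∀ x α, p.code₁ x α < p.q₁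
  code₂_lt : ∀ x α, p.code₂ x α < p.q₂
  agree₁ : ∀ u v, ident u ≠ ident v → 6 * p.K *
    ((Finset.range p.q₁).filter fun α => p.code₁ (ident u) α = p.code₁ (ident v) α).card ≤ p.q₁
  agree₂ : ∀ x < p.q₁ * p.q₁, ∀ x' < p.q₁ * p.q₁, x ≠ x' → 6 * p.K *
    ((Finset.range p.q₂).filter fun α => p.code₂ x α = p.code₂ x' α).card ≤ p.q₂

open Classical in
/-- What the processors remember about the network is true. -/
structure BaseOK (G : SimpleGraph V) (ident : V → ℕ) (β : V → Base) : Prop where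
  ident_eq : ∀ v, (β v).ident = ident v
  nbrs_eq : ∀ v, (β v).nbrs = (Finset.univ.filter (G.Adj v)).image ident
  nbrDeg_eq : ∀ v u, G.Adj v u → (β v).nbrDeg (ident u) = (β u).deg
  live_subset : ∀ v, (β v).live ⊆ (β v).nbrs
  deg_le : ∀ v, (β v).deg ≤ Fintype.card V

theorem BaseOK.mem_nbrs {β : V → Base} (hβ : BaseOK G ident β) (hid : Function.Injective ident)
    (v u : V) : ident u ∈ (β v).nbrs ↔ G.Adj v u := by
  rw [hβ.nbrs_eq]
  simp only [Finset.mem_image, Finset.mem_filter, Finset.mem_univ, true_and]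
  constructor
  · rintro ⟨u', h, h'⟩
    exact hid h' ▸ h
  · exact fun h => ⟨u, h, rfl⟩

open Classical in
theorem BaseOK.sum_nbrs {β : V → Base} (hβ : BaseOK G ident β) (hid : Function.Injective ident)
    {M : Type*} [AddCommMonoid M] (v : V) (f : ℕ → M) :
    ∑ j ∈ (β v).nbrs, f j = ∑ u, if G.Adj v u then f (ident u) else 0 := by
  rw [hβ.nbrs_eq, Finset.sum_image (fun a _ b _ h => hid h), Finset.sum_filter]

theorem Setting.pow_lt (hs : Setting ident p L) {x : ℕ} (hx : x ≤ 2 ^ (4 * p.K)) : x < 2 ^ L :=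
  lt_of_le_of_lt hx (Nat.pow_lt_pow_right (by norm_num) hs.len)

theorem Setting.card_le' (hs : Setting ident p L) : Fintype.card V ≤ 2 ^ p.K :=
  le_trans (by omega) hs.card_le

theorem Rounding.weight_eq_zero {g : Gender} {β : V → Base} {st : V → Node}
    (h : Rounding G ident p g β st) (hβ : BaseOK G ident β) (hid : Function.Injective ident)
    {v w : V} (hvw : ¬ G.Adj v w) : (st v).weight (ident w) = 0 := by
  obtain ⟨t, ht⟩ := h.level v
  refine ht.weight_eq_zero fun h' => hvw ?_
  have := hβ.live_subset v (h.base_eq v ▸ Base.targets_subset g _ h')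
  exact (hβ.mem_nbrs hid v w).1 this

theorem Rounding.shared_shareOp {g : Gender} {β : V → Base} {st : V → Node}
    (h : Rounding G ident p g β st) (hβ : BaseOK G ident β) (hs : Setting ident p L) :
    Shared ident (shareOp.apply G ident L st) := by
  intro u v
  change (if 0 < 1 then received G ident L (fun u k => (st u).weight k) v (ident u) else 0) =
    (st u).weight (ident v)
  rw [if_pos one_pos]
  by_cases hvu : G.Adj v u
  · exact received_of_adj hs.inj hvu (hs.pow_lt ((h.weight_le u _).trans
      (Nat.pow_le_pow_right (by norm_num) (by omega))))
  · rw [received_ident G hs.inj, if_neg hvu, h.weight_eq_zero hβ hs.inj fun h' => hvu h'.symm]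

theorem sum_ite_le_card_mul (r : V → Prop) [DecidablePred r] (f : V → ℕ) (b : ℕ)
    (h : ∀ v, f v ≤ b) : (∑ v, if r v then f v else 0) ≤ Fintype.card V * b := by
  calc (∑ v, if r v then f v else 0) ≤ ∑ _v : V, b := by
        refine Finset.sum_le_sum fun v _ => ?_
        split_ifs
        exacts [h v, Nat.zero_le _]
    _ = _ := by simp

/-- The sums that `w` computes from its memory are sums over the true shares and degrees of all
processors `u` whose colour is in the relation `r` to that of `v`. -/
theorem Rounding.sum_pairs {g : Gender} {β : V → Base} {st : V → Node}
    (h : Rounding G ident p g β st) (hβ : BaseOK G ident β) (hs : Setting ident p L)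
    (hsh : Shared ident st) (hcol : Colored G ident st) (v w : V) (hvw : G.Adj w v)
    (r : ℕ → ℕ → Prop) [DecidableRel r] (x : ℕ) :
    (∑ i ∈ (st w).base.nbrs, if r ((st w).nbrColor i) ((st w).nbrColor (ident v)) then
      (st w).base.pairWeight i (ident v) * (x * (st w).share i) else 0) =
    ∑ u, if r (st u).color (st v).color then
      min (β u).deg (β v).deg * (x * (st u).weight (ident w)) else 0 := by
  rw [h.base_eq w, hβ.sum_nbrs hs.inj]
  refine Finset.sum_congr rfl fun u _ => ?_
  by_cases hwu : G.Adj w u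
  · rw [if_pos hwu, hcol w u hwu, hcol w v hvw, Base.pairWeight, hβ.nbrDeg_eq w u hwu,
      hβ.nbrDeg_eq w v hvw, hsh u w]
  · rw [if_neg hwu, h.weight_eq_zero hβ hs.inj fun h' => hwu h'.symm]
    simp

theorem Rounding.sum_pairs_le {g : Gender} {β : V → Base} {st : V → Node}
    (h : Rounding G ident p g β st) (hβ : BaseOK G ident β) (hs : Setting ident p L)
    (v w : V) (r : ℕ → ℕ → Prop) [DecidableRel r] (x : ℕ) (hx : x ≤ 2 ^ p.K) :
    (∑ u, if r (st u).color (st v).color then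
      min (β u).deg (β v).deg * (x * (st u).weight (ident w)) else 0) < 2 ^ L := by
  refine hs.pow_lt ((sum_ite_le_card_mul _ _ (2 ^ p.K * (2 ^ p.K * 2 ^ p.K)) fun u => ?_).trans ?_)
  · refine Nat.mul_le_mul ?_ (Nat.mul_le_mul hx (h.weight_le u _))
    exact (min_le_left _ _).trans ((hβ.deg_le u).trans hs.card_le')
  · calc Fintype.card V * (2 ^ p.K * (2 ^ p.K * 2 ^ p.K))
        ≤ 2 ^ p.K * (2 ^ p.K * (2 ^ p.K * 2 ^ p.K)) := Nat.mul_le_mul_right _ hs.card_le'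
      _ = 2 ^ (4 * p.K) := by ring

open Classical in
/-- One level of the colouring makes at most one conflict in `6 K` monochromatic. -/
theorem Rounding.monoCost_recolorOp_le {g : Gender} {β : V → Base} {st : V → Node}
    (h : Rounding G ident p g β st) (hβ : BaseOK G ident β) (hs : Setting ident p L)
    (hsh : Shared ident st) (hcol : Colored G ident st) {q : ℕ} (hq : 0 < q)
    (code : ℕ → ℕ → ℕ) (hcode : ∀ x α, code x α < q)
    (hagree : ∀ u v, (st u).color ≠ (st v).color → 6 * p.K *
      ((Finset.range q).filter fun α =>
        code (st u).color α = code (st v).color α).card ≤ q) :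
    (∀ v, ((recolorOp q code).apply G ident L st v).color < q * q) ∧
    monoCost (fun v => ((recolorOp q code).apply G ident L st v).color) (minDeg β)
        (shares ident st) ≤
      monoCost (fun v => (st v).color) (minDeg β) (shares ident st) +
        1 / (6 * p.K) * cost (minDeg β) (shares ident st) := by
  -- `C v α` is the conflict of `v` at the position `α`, as it is added up from the messages.
  set C : V → ℕ → ℕ := fun v α => ∑ w, ∑ u,
    if (st u).color ≠ (st v).color ∧ code (st u).color α = code (st v).color α then
      min (β u).deg (β v).deg * ((st v).weight (ident w) * (st u).weight (ident w)) else 0 with hC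
  have hCcast : ∀ v α, (C v α : ℝ) =
      ∑ u, if (st u).color ≠ (st v).color ∧ code (st u).color α = code (st v).color α then
        conflict (minDeg β) (shares ident st) v u else 0 := by
    intro v α
    simp only [hC, Nat.cast_sum]
    rw [Finset.sum_comm]
    refine Finset.sum_congr rfl fun u _ => ?_
    split_ifs
    · rw [conflict, Finset.mul_sum]
      refine Finset.sum_congr rfl fun w _ => ?_
      simp only [shares, minDeg, degR, Nat.cast_mul, Nat.cast_min]
      rw [min_comm]
    · simp
  have hbuf : ∀ v, ∀ α < q, (∑ j ∈ (st v).base.nbrs, if α < q then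
      received G ident L (fun u k => (recolorOp q code).send (st u) k α) v j else 0) = C v α := by
    intro v α hα
    rw [h.base_eq v, hβ.sum_nbrs hs.inj]
    refine Finset.sum_congr rfl fun w _ => ?_
    by_cases hvw : G.Adj v w
    · have h1 := h.sum_pairs hβ hs hsh hcol v w hvw.symm
        (fun a b => a ≠ b ∧ code a α = code b α) ((st v).weight (ident w))
      have h2 := h.sum_pairs_le hβ hs v w (fun a b => a ≠ b ∧ code a α = code b α)
        ((st v).weight (ident w)) (h.weight_le v _)
      rw [← h1, ← hsh v w] at h2
      rw [if_pos hvw, if_pos hα, received_of_adj hs.inj hvw h2, ← h1, ← hsh v w]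
      rfl
    · rw [if_neg hvw, h.weight_eq_zero hβ hs.inj hvw]
      simp
  have hcolor : ∀ v, ∃ α < q, (∀ β < q, C v α ≤ C v β) ∧
      ((recolorOp q code).apply G ident L st v).color =
        α * q + code (st v).color α := by
    intro v
    have hspec := argminBelow_spec hq (fun α => ∑ j ∈ (st v).base.nbrs, if α < q then
      received G ident L (fun u k => (recolorOp q code).send (st u) k α) v j else 0)
    refine ⟨_, hspec.1, fun β hβ => ?_, rfl⟩
    have h1 := hspec.2 β hβ
    rwa [hbuf v _ hspec.1, hbuf v _ hβ] at h1
  choose pos hpos hmin hnew using hcolor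
  refine ⟨fun v => ?_, ?_⟩
  · rw [hnew]
    calc pos v * q + code (st v).color (pos v) < pos v * q + q :=
          Nat.add_lt_add_left (hcode _ _) _
      _ = (pos v + 1) * q := by ring
      _ ≤ q * q := Nat.mul_le_mul_right _ (hpos v)
  · simp only [hnew]
    have hK : 0 < 6 * p.K := Nat.mul_pos (by norm_num) hs.K_pos
    have := monoCost_recolor_le (d := q / (6 * p.K)) hq code (fun v => (st v).color) pos
      (minDeg_nonneg β) (shares_nonneg ident st) (fun v α _ => hcode _ α)
      (fun u v huv => (Nat.le_div_iff_mul_le hK).2 (by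
        rw [mul_comm]
        exact hagree u v huv)) hpos
      (fun v γ hγ => by
        rw [← hCcast, ← hCcast]
        exact_mod_cast hmin v γ hγ)
    refine this.trans (add_le_add le_rfl (mul_le_mul_of_nonneg_right ?_
      (costOn_nonneg _ (minDeg_nonneg β) (shares_nonneg ident st))))
    have hq' : (0 : ℝ) < q := by exact_mod_cast hq
    have hK' : (0 : ℝ) < 6 * p.K := by exact_mod_cast hK
    rw [div_le_div_iff₀ hq' hK', one_mul]
    exact_mod_cast Nat.div_mul_le_self q (6 * p.K)

end Rounding

/-! ### Halving the lists of labels -/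

theorem labelsValue_take_add_drop (N : ℕ) (l : ℝ) (b : Base) (price : ℕ → ℕ) (scale h : ℕ)
    (labels : List (Option ℕ)) :
    labelsValue N l b price (2 * scale) (labels.take h) +
      labelsValue N l b price (2 * scale) (labels.drop h) =
      2 * labelsValue N l b price scale labels := by
  simp only [labelsValue, Finset.mul_sum, ← Finset.sum_add_distrib]
  refine Finset.sum_congr rfl fun j _ => ?_
  have : labels.count (some j) = (labels.take h).count (some j) + (labels.drop h).count (some j) := by
    rw [← List.count_append, List.take_append_drop]
  rw [this]
  push_cast
  ring

/-- The two halves, at the doubled scale, have on average the value of the whole list. -/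
theorem labelsValue_le_betterHalf (N : ℕ) (l : ℝ) (b : Base) (price : ℕ → ℕ) (scale : ℕ)
    (labels : List (Option ℕ)) :
    labelsValue N l b price scale labels ≤
      labelsValue N l b price (2 * scale) (betterHalf N l b price (2 * scale) labels) := by
  have h := labelsValue_take_add_drop N l b price scale (labels.length / 2) labels
  unfold betterHalf
  split_ifs with h' <;> linarith

theorem betterHalf_sublist (N : ℕ) (l : ℝ) (b : Base) (price : ℕ → ℕ) (scale : ℕ)
    (labels : List (Option ℕ)) : (betterHalf N l b price scale labels).Sublist labels := by
  unfold betterHalf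
  split_ifs
  exacts [List.take_sublist _ _, List.drop_sublist _ _]

theorem length_betterHalf (N : ℕ) (l : ℝ) (b : Base) (price : ℕ → ℕ) (scale : ℕ)
    {labels : List (Option ℕ)} {h : ℕ} (hl : labels.length = 2 * h) :
    (betterHalf N l b price scale labels).length = h := by
  unfold betterHalf
  split_ifs <;> simp [hl] <;> omega

/-- The effect on one processor of a halving at given prices. -/
noncomputable def Node.halve (N : ℕ) (l : ℝ) (price : ℕ → ℕ) (s : Node) : Node :=
  { s with
    labels := betterHalf N l s.base price (2 * s.scale) s.labels
    scale := 2 * s.scale }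

theorem Level.halve {g : Gender} {K t : ℕ} {s : Node} (h : Level g K t s) (ht : t < K)
    (N : ℕ) (l : ℝ) (price : ℕ → ℕ) : Level g K (t + 1) (s.halve N l price) where
  le := ht
  scale_eq := by simp [Node.halve, h.scale_eq, pow_succ']
  length_eq := length_betterHalf _ _ _ _ _ (by
    rw [h.length_eq, ← pow_succ']
    congr 1
    omega)
  support j hj := h.support j ((betterHalf_sublist _ _ _ _ _ _).subset hj)

theorem Node.weight_halve_le (N : ℕ) (l : ℝ) (price : ℕ → ℕ) (s : Node) (j : ℕ) :
    (s.halve N l price).weight j ≤ 2 * s.weight j := by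
  have h : (betterHalf N l s.base price (2 * s.scale) s.labels).count (some j) ≤
      s.labels.count (some j) := (betterHalf_sublist _ _ _ _ _ _).count_le _
  calc (s.halve N l price).weight j ≤ 2 * s.scale * s.labels.count (some j) :=
        Nat.mul_le_mul_left _ h
    _ = _ := by rw [Node.weight, mul_assoc]

section Steps

variable {V : Type} [Fintype V] {G : SimpleGraph V} {ident : V → ℕ} {p : Params} {L : ℕ}

/-- The utility of the shares less their conflicts, with factor `l`. -/
noncomputable def objective (ident : V → ℕ) (N : ℕ) (β : V → Base) (l : ℝ) (st : V → Node) : ℝ :=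
  utility (fun v => N * degR β v) (shares ident st) -
    l / 2 * cost (minDeg β) (shares ident st)

open Classical in
/-- Halving takes place at the prices that correspond to the current shares. -/
theorem Rounding.halveOp_apply {g : Gender} {β : V → Base} {st : V → Node}
    (h : Rounding G ident p g β st) (hβ : BaseOK G ident β) (hs : Setting ident p L)
    (hsh : Shared ident st) (hcol : Colored G ident st) (κ : ℕ) (l : ℝ) :
    ∃ price : V → ℕ → ℕ,
      (∀ v w, G.Adj v w → (price v (ident w) : ℝ) =
        AlmostStable.price (fun v => (st v).color) (minDeg β) (shares ident st) v w) ∧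
      (halveOp (2 ^ p.K) κ l).apply G ident L st = fun v =>
        if (st v).color = κ then (st v).halve (2 ^ p.K) l (price v) else st v := by
  refine ⟨fun v j => if 0 < 1 then
    received G ident L (fun u k => (halveOp (2 ^ p.K) κ l).send (st u) k 0) v j else 0, ?_, rfl⟩
  intro v w hvw
  have h1 := h.sum_pairs hβ hs hsh hcol v w hvw.symm (fun a b => a ≠ b) 1
  have h2 := h.sum_pairs_le hβ hs v w (fun a b => a ≠ b) 1 Nat.one_le_two_pow
  rw [← h1] at h2
  simp only [one_mul] at h1 h2
  simp only [one_pos, if_true]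
  rw [received_of_adj hs.inj hvw h2]
  simp only [halveOp]
  rw [h1, AlmostStable.price, Nat.cast_sum]
  refine Finset.sum_congr rfl fun u _ => ?_
  split_ifs
  · simp [shares, minDeg, degR]
  · simp

/-- The states in the course of a halving step: those whose colour is less than `κ` have been
halved, and the bichromatic part of the objective has not decreased. -/
structure Halving (G : SimpleGraph V) (ident : V → ℕ) (p : Params) (g : Gender) (β : V → Base)
    (t : ℕ) (st₀ : V → Node) (κ : ℕ) (st : V → Node) : Prop where
  base_eq : ∀ v, (st v).base = β v
  color_eq : ∀ v, (st v).color = (st₀ v).color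
  colored : Colored G ident st
  done : ∀ v, (st₀ v).color < κ → Level g p.K (t + 1) (st v)
  todo : ∀ v, κ ≤ (st₀ v).color → (st v).labels = (st₀ v).labels ∧ (st v).scale = (st₀ v).scale
  weight_le : ∀ v j, (st v).weight j ≤ 2 * (st₀ v).weight j
  objective_le :
    utility (fun v => 2 ^ p.K * degR β v) (shares ident st₀) - p.factor (t + 1) / 2 *
        biCost (fun v => (st₀ v).color) (minDeg β) (shares ident st₀) ≤
      utility (fun v => 2 ^ p.K * degR β v) (shares ident st) - p.factor (t + 1) / 2 *
        biCost (fun v => (st₀ v).color) (minDeg β) (shares ident st)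

theorem Halving.level_of_le {g : Gender} {β : V → Base} {t κ : ℕ} {st₀ st : V → Node}
    (h : Halving G ident p g β t st₀ κ st) (hb : ∀ v, (st₀ v).base = β v)
    (h₀ : ∀ v, Level g p.K t (st₀ v)) {v : V} (hv : κ ≤ (st₀ v).color) :
    Level g p.K t (st v) where
  le := (h₀ v).le
  scale_eq := (h.todo v hv).2.trans (h₀ v).scale_eq
  length_eq := by rw [(h.todo v hv).1, (h₀ v).length_eq]
  support := by
    rw [(h.todo v hv).1, h.base_eq v, ← hb v]
    exact (h₀ v).support

open Classical in
/-- One more colour class halves its lists, and by `objective_update` the change of the bichromatic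
objective is the sum of the gains of its members. -/
theorem Halving.classOps {g : Gender} {β : V → Base} {t κ : ℕ} {st₀ st : V → Node}
    (h : Halving G ident p g β t st₀ κ st) (hb : ∀ v, (st₀ v).base = β v)
    (h₀ : ∀ v, Level g p.K t (st₀ v)) (ht : t < p.K)
    (hβ : BaseOK G ident β) (hs : Setting ident p L) :
    Halving G ident p g β t st₀ (κ + 1) (runOps G ident L (p.classOps t κ) st) := by
  have hr : Rounding G ident p g β st := ⟨h.base_eq, fun v =>
    if hv : (st₀ v).color < κ then ⟨_, h.done v hv⟩
    else ⟨_, h.level_of_le hb h₀ (not_lt.1 hv)⟩⟩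
  set st₁ := shareOp.apply G ident L st with hst₁
  have hr₁ : Rounding G ident p g β st₁ := ⟨hr.base_eq, fun v =>
    let ⟨t', ht'⟩ := hr.level v
    ⟨t', ht'.le, ht'.scale_eq, ht'.length_eq, ht'.support⟩⟩
  obtain ⟨price, hprice, hst₂⟩ := hr₁.halveOp_apply hβ hs (hr.shared_shareOp hβ hs)
    (κ := κ) (l := p.factor (t + 1)) (fun v u hvu => h.colored v u hvu)
  have hrun : runOps G ident L (p.classOps t κ) st = fun v =>
      if (st₀ v).color = κ then (st₁ v).halve (2 ^ p.K) (p.factor (t + 1)) (price v)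
      else st₁ v := by
    rw [Params.classOps, runOps_cons, runOps_cons, runOps_nil, hst₂]
    funext v
    rw [show (st₁ v).color = (st₀ v).color from h.color_eq v]
  rw [hrun]
  have hcolor : ∀ v, ((if (st₀ v).color = κ then
      (st₁ v).halve (2 ^ p.K) (p.factor (t + 1)) (price v) else st₁ v) : Node).color =
      (st₀ v).color := by
    intro v
    split_ifs
    exacts [h.color_eq v, h.color_eq v]
  refine ⟨fun v => ?_, hcolor, fun v u hvu => ?_, fun v hv => ?_, fun v hv => ?_, fun v j => ?_,
    h.objective_le.trans ?_⟩
  · split_ifs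
    exacts [h.base_eq v, h.base_eq v]
  · rw [hcolor u, ← h.color_eq u, ← h.colored v u hvu]
    split_ifs <;> rfl
  · split_ifs with hκ
    · have h1 := h.level_of_le hb h₀ hκ.ge
      exact Level.halve (s := st₁ v) ⟨h1.le, h1.scale_eq, h1.length_eq, h1.support⟩ ht _ _ _
    · have h1 := h.done v (by omega)
      exact ⟨h1.le, h1.scale_eq, h1.length_eq, h1.support⟩
  · rw [if_neg (by omega)]
    exact h.todo v (by omega)
  · split_ifs with hκ
    · refine (Node.weight_halve_le _ _ _ _ _).trans (Nat.mul_le_mul_left _ (le_of_eq ?_))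
      change (st v).scale * (st v).labels.count (some j) = _
      rw [(h.todo v hκ.ge).1, (h.todo v hκ.ge).2]
      rfl
    · exact h.weight_le v j
  · set st₂ : V → Node := fun v => if (st₀ v).color = κ then
      (st₁ v).halve (2 ^ p.K) (p.factor (t + 1)) (price v) else st₁ v with hst₂'
    have hupd := objective_update (fun v => (st₀ v).color) κ (fun v => 2 ^ p.K * degR β v)
      (minDeg β) (shares ident st) (shares ident st₂) (p.factor (t + 1)) (minDeg_comm β)
      (fun v hv => by
        funext w
        simp only [shares, hst₂', if_neg hv]
        rfl)
    rw [hupd]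
    refine le_add_of_nonneg_right (Finset.sum_nonneg fun v _ => ?_)
    split_ifs with hκ
    -- The gain of a member of the class is nonnegative by the choice of the better half; only
    -- neighbours contribute to the values of the halves.
    · have hval := labelsValue_le_betterHalf (2 ^ p.K) (p.factor (t + 1)) (st₁ v).base (price v)
        (st₁ v).scale (st₁ v).labels
      have hl1 : Level g p.K t (st v) := h.level_of_le hb h₀ hκ.ge
      have hl2 : Level g p.K (t + 1) (st₂ v) := by
        simp only [hst₂', if_pos hκ]
        exact Level.halve (s := st₁ v) ⟨hl1.le, hl1.scale_eq, hl1.length_eq, hl1.support⟩ ht _ _ _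
      have hconv : ∀ s : Node, ∀ t', s.base = β v → Level g p.K t' s →
          labelsValue (2 ^ p.K) (p.factor (t + 1)) (st₁ v).base (price v) s.scale s.labels =
          ∑ w, (s.weight (ident w) : ℝ) * (2 ^ p.K * degR β v - p.factor (t + 1) *
            AlmostStable.price (fun v => (st₀ v).color) (minDeg β) (shares ident st) v w) := by
        intro s t' hsb hsl
        rw [labelsValue, show (st₁ v).base = β v from h.base_eq v, hβ.sum_nbrs hs.inj]
        refine Finset.sum_congr rfl fun w _ => ?_
        split_ifs with hvw
        · rw [hprice v w hvw]
          have hc : (fun v => (st₁ v).color) = fun v => (st₀ v).color := funext h.color_eq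
          rw [hc]
          simp only [degR, Nat.cast_pow, Nat.cast_ofNat]
          rfl
        · rw [hsl.weight_eq_zero]
          · simp
          · intro hw
            refine hvw ((hβ.mem_nbrs hs.inj v w).1 (hβ.live_subset v ?_))
            rw [hsb] at hw
            exact Base.targets_subset g _ hw
      have e1 := hconv (st₁ v) t (h.base_eq v)
        ⟨hl1.le, hl1.scale_eq, hl1.length_eq, hl1.support⟩
      have e2 := hconv (st₂ v) (t + 1) (by
        simp only [hst₂', if_pos hκ]
        exact h.base_eq v) hl2
      have e3 : labelsValue (2 ^ p.K) (p.factor (t + 1)) (st₁ v).base (price v) (st₂ v).scale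
          (st₂ v).labels = labelsValue (2 ^ p.K) (p.factor (t + 1)) (st₁ v).base (price v)
            (2 * (st₁ v).scale) (betterHalf (2 ^ p.K) (p.factor (t + 1)) (st₁ v).base (price v)
              (2 * (st₁ v).scale) (st₁ v).labels) := by
        simp only [hst₂', if_pos hκ]
        rfl
      rw [← e3, e1, e2, ← sub_nonneg, ← Finset.sum_sub_distrib] at hval
      refine hval.trans (le_of_eq (Finset.sum_congr rfl fun w _ => ?_))
      rw [← sub_mul]
      rfl
    · exact le_rfl

theorem Params.factor_nonneg (p : Params) (t : ℕ) : 0 ≤ p.factor t := by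
  unfold Params.factor
  positivity

theorem Params.factor_succ_mul (p : Params) {t : ℕ} (ht : t < p.K) :
    p.factor (t + 1) * (1 + 1 / (p.K : ℝ)) = p.factor t := by
  unfold Params.factor
  rw [← pow_succ]
  congr 1
  omega

theorem Params.factor_zero_le (p : Params) : p.factor 0 ≤ 4 := by
  unfold Params.factor
  rw [Nat.sub_zero]
  rcases Nat.eq_zero_or_pos p.K with h | h
  · simp [h]
  have hK : (0 : ℝ) < p.K := by exact_mod_cast h
  calc (1 + 1 / (p.K : ℝ)) ^ p.K ≤ (Real.exp (1 / p.K)) ^ p.K := by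
        refine pow_le_pow_left₀ (by positivity) ?_ _
        rw [add_comm]
        exact Real.add_one_le_exp _
    _ = Real.exp 1 := by
        rw [← Real.exp_nat_mul]
        congr 1
        field_simp
    _ ≤ 4 := by linarith [Real.exp_one_lt_d9]

/-- The two levels of recolouring give `q₂ ^ 2` colours such that at most a fraction `1 / (3 K)`
of the conflicts is monochromatic. -/
theorem colorOps_spec {g : Gender} {β : V → Base} {t : ℕ} {st : V → Node}
    (hb : ∀ v, (st v).base = β v) (hl : ∀ v, Level g p.K t (st v))
    (hβ : BaseOK G ident β) (hs : Setting ident p L) :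
    ∃ st' : V → Node, runOps G ident L p.colorOps st = st' ∧
      (∀ v, (st' v).base = β v) ∧ (∀ v, Level g p.K t (st' v)) ∧
      shares ident st' = shares ident st ∧ Colored G ident st' ∧
      (∀ v, (st' v).color < p.q₂ * p.q₂) ∧
      monoCost (fun v => (st' v).color) (minDeg β) (shares ident st') ≤
        1 / (3 * p.K) * cost (minDeg β) (shares ident st') := by
  set st₁ := resetColorOp.apply G ident L st with h₁
  set st₂ := shareOp.apply G ident L st₁ with h₂
  set st₃ := (recolorOp p.q₁ p.code₁).apply G ident L st₂ with h₃
  set st₄ := colorOp.apply G ident L st₃ with h₄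
  set st₅ := (recolorOp p.q₂ p.code₂).apply G ident L st₄ with h₅
  set st₆ := colorOp.apply G ident L st₅ with h₆
  have hl' : ∀ s s' : Node, s'.base = s.base → s'.labels = s.labels → s'.scale = s.scale →
      Level g p.K t s → Level g p.K t s' := fun s s' e1 e2 e3 h =>
    ⟨h.le, e3 ▸ h.scale_eq, e2 ▸ h.length_eq, by rw [e1, e2]; exact h.support⟩
  have r₁ : Rounding G ident p g β st₁ :=
    ⟨hb, fun v => ⟨t, hl' (st v) _ rfl rfl rfl (hl v)⟩⟩
  have r₂ : Rounding G ident p g β st₂ :=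
    ⟨hb, fun v => ⟨t, hl' (st v) _ rfl rfl rfl (hl v)⟩⟩
  have r₄ : Rounding G ident p g β st₄ :=
    ⟨hb, fun v => ⟨t, hl' (st v) _ rfl rfl rfl (hl v)⟩⟩
  have sh₂ : Shared ident st₂ := r₁.shared_shareOp hβ hs
  have hcol₂ : ∀ v, (st₂ v).color = ident v := fun v =>
    (congrArg Base.ident (hb v)).trans (hβ.ident_eq v)
  have c₂ : Colored G ident st₂ := fun v u _ => (hcol₂ u).symm
  obtain ⟨lt₃, mono₃⟩ := r₂.monoCost_recolorOp_le hβ hs sh₂ c₂ hs.q₁_pos p.code₁ hs.code₁_lt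
    (fun u v huv => by
      rw [hcol₂, hcol₂] at huv ⊢
      exact hs.agree₁ u v huv)
  have c₄ : Colored G ident st₄ :=
    colored_colorOp hs.inj fun v => (lt₃ v).trans_le hs.q₁_len
  obtain ⟨lt₅, mono₅⟩ := r₄.monoCost_recolorOp_le hβ hs sh₂ c₄ hs.q₂_pos p.code₂ hs.code₂_lt
    (fun u v huv => hs.agree₂ _ (lt₃ u) _ (lt₃ v) huv)
  have c₆ : Colored G ident st₆ :=
    colored_colorOp hs.inj fun v => (lt₅ v).trans_le hs.q₂_len
  refine ⟨st₆, rfl, hb, fun v => hl' (st v) _ rfl rfl rfl (hl v), rfl, c₆, lt₅, ?_⟩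
  have hm0 : monoCost (fun v => (st₂ v).color) (minDeg β) (shares ident st₂) = 0 :=
    monoCost_of_injective (fun u v h => hs.inj (by rwa [hcol₂, hcol₂] at h)) _ _
  rw [hm0, zero_add] at mono₃
  have hK : (0 : ℝ) < p.K := by exact_mod_cast hs.K_pos
  calc monoCost (fun v => (st₆ v).color) (minDeg β) (shares ident st₆)
      ≤ monoCost (fun v => (st₃ v).color) (minDeg β) (shares ident st₂) +
        1 / (6 * p.K) * cost (minDeg β) (shares ident st₂) := mono₅
    _ ≤ 1 / (6 * p.K) * cost (minDeg β) (shares ident st₂) +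
        1 / (6 * p.K) * cost (minDeg β) (shares ident st₂) := by gcongr
    _ = 1 / (3 * p.K) * cost (minDeg β) (shares ident st₂) := by
        field_simp
        ring

/-- A halving step does not decrease the objective, when the factor of the conflicts is adapted:
the bichromatic part does not decrease, and the small monochromatic part is multiplied by at most
four. -/
theorem stepOps_spec {g : Gender} {β : V → Base} {t : ℕ} {st : V → Node}
    (hb : ∀ v, (st v).base = β v) (hl : ∀ v, Level g p.K t (st v)) (ht : t < p.K)
    (hβ : BaseOK G ident β) (hs : Setting ident p L) :
    (∀ v, (runOps G ident L (p.stepOps t) st v).base = β v) ∧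
    (∀ v, Level g p.K (t + 1) (runOps G ident L (p.stepOps t) st v)) ∧
    objective ident (2 ^ p.K) β (p.factor t) st ≤
      objective ident (2 ^ p.K) β (p.factor (t + 1)) (runOps G ident L (p.stepOps t) st) := by
  obtain ⟨st₀, hrun, hb₀, hl₀, hsh, hcol, hlt, hmono⟩ := colorOps_spec hb hl hβ hs
  have hloop : ∀ κ, Halving G ident p g β t st₀ κ
      (runOps G ident L ((List.range κ).flatMap (p.classOps t)) st₀) := by
    intro κ
    induction κ with
    | zero =>
      exact ⟨hb₀, fun _ => rfl, hcol, fun v hv => absurd hv (Nat.not_lt_zero _),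
        fun v _ => ⟨rfl, rfl⟩, fun v j => Nat.le_mul_of_pos_left _ (by norm_num), le_rfl⟩
    | succ κ ih =>
      rw [runOps_flatMap_succ]
      exact ih.classOps hb₀ hl₀ ht hβ hs
  have hfin := hloop (p.q₂ * p.q₂)
  rw [Params.stepOps, runOps_append, hrun]
  set st' := runOps G ident L ((List.range (p.q₂ * p.q₂)).flatMap (p.classOps t)) st₀
  refine ⟨hfin.base_eq, fun v => hfin.done v (hlt v), ?_⟩
  have h4 : monoCost (fun v => (st₀ v).color) (minDeg β) (shares ident st') ≤
      4 * monoCost (fun v => (st₀ v).color) (minDeg β) (shares ident st₀) :=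
    costOn_le_four_mul _ (minDeg_nonneg β) (shares_nonneg ident st') fun u v => by
      simp only [shares]
      exact_mod_cast hfin.weight_le u (ident v)
  have hobj := hfin.objective_le
  have hf := p.factor_nonneg (t + 1)
  have hK : (0 : ℝ) < p.K := by exact_mod_cast hs.K_pos
  unfold objective
  rw [← hsh, ← p.factor_succ_mul ht, cost_eq (fun v => (st₀ v).color) _ (shares ident st')]
  have hc := cost_eq (fun v => (st₀ v).color) (minDeg β) (shares ident st₀)
  set X := cost (minDeg β) (shares ident st₀)
  have h5 : monoCost (fun v => (st₀ v).color) (minDeg β) (shares ident st') +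
      biCost (fun v => (st₀ v).color) (minDeg β) (shares ident st₀) ≤
        (1 + 1 / (p.K : ℝ)) * X := by
    have : 1 / (3 * (p.K : ℝ)) * X = 1 / p.K * X / 3 := by
      field_simp
    rw [this] at hmono
    linarith
  have h6 := mul_le_mul_of_nonneg_left h5 (div_nonneg hf (zero_le_two (α := ℝ)))
  push_cast
  linarith

theorem roundingOps_spec {g : Gender} {β : V → Base} {st : V → Node}
    (hb : ∀ v, (st v).base = β v) (hl : ∀ v, Level g p.K 0 (st v))
    (hβ : BaseOK G ident β) (hs : Setting ident p L) :
    (∀ v, (runOps G ident L p.roundingOps st v).base = β v) ∧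
    (∀ v, Level g p.K p.K (runOps G ident L p.roundingOps st v)) ∧
    objective ident (2 ^ p.K) β (p.factor 0) st ≤
      objective ident (2 ^ p.K) β 1 (runOps G ident L p.roundingOps st) := by
  have h : ∀ t ≤ p.K,
      (∀ v, (runOps G ident L ((List.range t).flatMap p.stepOps) st v).base = β v) ∧
      (∀ v, Level g p.K t (runOps G ident L ((List.range t).flatMap p.stepOps) st v)) ∧
      objective ident (2 ^ p.K) β (p.factor 0) st ≤ objective ident (2 ^ p.K) β (p.factor t)
        (runOps G ident L ((List.range t).flatMap p.stepOps) st) := by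
    intro t
    induction t with
    | zero => exact fun _ => ⟨hb, hl, le_rfl⟩
    | succ t ih =>
      intro ht
      obtain ⟨h1, h2, h3⟩ := ih (by omega)
      obtain ⟨h1', h2', h3'⟩ := stepOps_spec h1 h2 ht hβ hs
      rw [runOps_flatMap_succ]
      exact ⟨h1', h2', h3.trans h3'⟩
  have := h p.K le_rfl
  rwa [show p.factor p.K = 1 by simp [Params.factor]] at this

end Steps

/-! ### Phases -/

theorem count_initialLabels (g : Gender) (N : ℕ) (b : Base) (j : ℕ) :
    (initialLabels g N b).count (some j) = if j ∈ b.targets g then N / (4 * b.deg) else 0 := by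
  simp only [initialLabels, List.count_append, List.count_flatMap, List.count_replicate]
  rw [if_neg (by simp), add_zero]
  have h : ∀ f : ℕ → ℕ, ((b.targets g).sort.map f).sum = ∑ i ∈ b.targets g, f i := by
    intro f
    rw [← Multiset.sum_coe, ← Multiset.map_coe, Finset.sort_eq]
    rfl
  rw [h]
  simp only [Function.comp_def, List.count_replicate, beq_iff_eq, Option.some.injEq]
  rw [Finset.sum_ite_eq']

theorem length_initialLabels (g : Gender) (N : ℕ) (b : Base) (h : (b.targets g).card ≤ b.deg) :
    (initialLabels g N b).length = N := by
  simp only [initialLabels, List.length_append, List.length_replicate]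
  refine Nat.add_sub_of_le ?_
  rw [List.length_flatMap]
  simp only [List.length_replicate, List.map_const', List.sum_replicate, Finset.length_sort,
    smul_eq_mul]
  calc (b.targets g).card * (N / (4 * b.deg)) ≤ (4 * b.deg) * (N / (4 * b.deg)) :=
        Nat.mul_le_mul_right _ (by omega)
    _ ≤ N := Nat.mul_div_le _ _

theorem mem_initialLabels {g : Gender} {N : ℕ} {b : Base} {j : ℕ}
    (h : some j ∈ initialLabels g N b) : j ∈ b.targets g := by
  by_contra hj
  have := count_initialLabels g N b j
  rw [if_neg hj] at this
  exact List.count_eq_zero.1 this h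

section Phase

variable {V : Type} {G : SimpleGraph V} {ident : V → ℕ} {p : Params} {L : ℕ}

/-- The edges between unmatched processors. -/
def LiveAdj (G : SimpleGraph V) (β : V → Base) (v u : V) : Prop :=
  G.Adj v u ∧ (β v).mate = none ∧ (β u).mate = none

theorem LiveAdj.symm {β : V → Base} {v u : V} (h : LiveAdj G β v u) : LiveAdj G β u v :=
  ⟨h.1.symm, h.2.2, h.2.1⟩

/-- What the processors remember between two exchanges of a phase or iteration, apart from the
degrees: partners in the matching know each other, and every unmatched processor knows its unmatched
neighbours. -/
structure NetOK (G : SimpleGraph V) (ident : V → ℕ) (β : V → Base) : Prop where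
  ident_eq : ∀ v, (β v).ident = ident v
  mem_nbrs : ∀ v j, j ∈ (β v).nbrs ↔ ∃ u, G.Adj v u ∧ ident u = j
  gender_ne : ∀ v u, G.Adj v u → (β v).gender ≠ (β u).gender
  mate_symm : ∀ v j, (β v).mate = some j →
    ∃ u, ident u = j ∧ G.Adj v u ∧ (β u).mate = some (ident v)
  mem_live : ∀ v j, j ∈ (β v).live ↔ ∃ u, LiveAdj G β v u ∧ ident u = j

theorem NetOK.live_subset {β : V → Base} (h : NetOK G ident β) (v : V) :
    (β v).live ⊆ (β v).nbrs := by
  intro j hj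
  obtain ⟨u, hu, rfl⟩ := (h.mem_live v j).1 hj
  exact (h.mem_nbrs v _).2 ⟨u, hu.1, rfl⟩

theorem NetOK.ident_mem_live {β : V → Base} (h : NetOK G ident β)
    (hid : Function.Injective ident) (v u : V) : ident u ∈ (β v).live ↔ LiveAdj G β v u := by
  rw [h.mem_live]
  constructor
  · rintro ⟨u', h1, h2⟩
    exact hid h2 ▸ h1
  · exact fun h => ⟨u, h, rfl⟩

/-- At the end of the rounding, `v` has a single label, which stands for `w`. -/
def Proposes (ident : V → ℕ) (st : V → Node) (v w : V) : Prop :=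
  (st v).labels = [some (ident w)]

open Classical in
theorem Level.weight_final {g : Gender} {K : ℕ} {st : V → Node} {v : V}
    (h : Level g K K (st v)) (w : V) :
    (st v).weight (ident w) = if Proposes ident st v w then 2 ^ K else 0 := by
  have hl := h.length_eq
  rw [Nat.sub_self, pow_zero, List.length_eq_one_iff] at hl
  obtain ⟨o, ho⟩ := hl
  rw [Node.weight, Proposes, h.scale_eq, ho]
  by_cases hc : o = some (ident w)
  · simp [hc]
  · simp [hc]

theorem Proposes.unique {st : V → Node} (hid : Function.Injective ident) {v w w' : V}
    (h : Proposes ident st v w) (h' : Proposes ident st v w') : w = w' := by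
  have := h.symm.trans h'
  simpa [hid.eq_iff] using this

variable [Fintype V]

/-- In addition, the degrees are known. They need not be up to date. -/
structure DegOK (G : SimpleGraph V) (ident : V → ℕ) (β : V → Base) : Prop extends
    NetOK G ident β where
  nbrDeg_eq : ∀ v u, G.Adj v u → (β v).nbrDeg (ident u) = (β u).deg
  deg_le : ∀ v, (β v).deg ≤ Fintype.card V
  live_card_le : ∀ v, (β v).live.card ≤ (β v).deg

theorem DegOK.baseOK {β : V → Base} (h : DegOK G ident β) : BaseOK G ident β where
  ident_eq := h.ident_eq
  nbrs_eq v := by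
    ext j
    rw [h.mem_nbrs]
    simp
  nbrDeg_eq := h.nbrDeg_eq
  live_subset := h.live_subset
  deg_le := h.deg_le

/-- The edges along which the processors of gender `g` can propose: both endpoints are unmatched, and
the degree of the proposer is at least as large as that of the other endpoint. -/
def Proposable (G : SimpleGraph V) (g : Gender) (β : V → Base) (v w : V) : Prop :=
  (β v).gender = g ∧ LiveAdj G β v w ∧ (β w).deg ≤ (β v).deg

theorem DegOK.ident_mem_targets {β : V → Base} (h : DegOK G ident β)
    (hid : Function.Injective ident) (g : Gender) (v w : V) :
    ident w ∈ (β v).targets g ↔ Proposable G g β v w := by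
  unfold Base.targets Proposable
  split_ifs with hg
  · rw [Finset.mem_filter, h.ident_mem_live hid]
    constructor
    · exact fun h' => ⟨hg, h'.1, h.nbrDeg_eq v w h'.1.1 ▸ h'.2⟩
    · exact fun h' => ⟨h'.2.1, (h.nbrDeg_eq v w h'.2.1.1).symm ▸ h'.2.2⟩
  · simp [hg]

theorem DegOK.level_startOp {β : V → Base} {st : V → Node} (h : DegOK G ident β)
    (hb : ∀ v, (st v).base = β v) (g : Gender) (v : V) :
    Level g p.K 0 ((startOp g (2 ^ p.K)).apply G ident L st v) where
  le := Nat.zero_le _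
  scale_eq := rfl
  length_eq := by
    refine length_initialLabels g _ _ ?_
    rw [hb v]
    exact (Finset.card_le_card (Base.targets_subset g _)).trans (h.live_card_le v)
  support j hj := mem_initialLabels hj

open Classical in
theorem DegOK.shares_startOp {β : V → Base} {st : V → Node} (h : DegOK G ident β)
    (hb : ∀ v, (st v).base = β v) (hid : Function.Injective ident) (g : Gender) (v w : V) :
    shares ident ((startOp g (2 ^ p.K)).apply G ident L st) v w =
      if Proposable G g β v w then ((2 ^ p.K / (4 * (β v).deg) : ℕ) : ℝ) else 0 := by
  have h1 : ((startOp g (2 ^ p.K)).apply G ident L st v).weight (ident w) =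
      1 * (initialLabels g (2 ^ p.K) (st v).base).count (some (ident w)) := rfl
  rw [shares, h1, hb v, count_initialLabels, one_mul]
  simp only [h.ident_mem_targets hid]
  split_ifs <;> simp

open Classical in
/-- The objective at the start of a phase. -/
theorem DegOK.le_objective_startOp {β : V → Base} {st : V → Node} (h : DegOK G ident β)
    (hb : ∀ v, (st v).base = β v) (hs : Setting ident p L) (g : Gender) :
    (2 ^ p.K : ℝ) ^ 2 * ((∑ v, ∑ w, if Proposable G g β v w then 1 else 0 : ℕ) : ℝ) / 16 ≤
      objective ident (2 ^ p.K) β (p.factor 0)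
        ((startOp g (2 ^ p.K)).apply G ident L st) := by
  set y := shares ident ((startOp g (2 ^ p.K)).apply G ident L st) with hy
  have hyv : ∀ v w, y v w = if Proposable G g β v w then
      ((2 ^ p.K / (4 * (β v).deg) : ℕ) : ℝ) else 0 := h.shares_startOp hb hs.inj g
  have hdeg : ∀ v w, LiveAdj G β v w → 0 < (β v).deg := fun v w hvw =>
    (Finset.card_pos.2 ⟨ident w, (h.ident_mem_live hs.inj v w).2 hvw⟩).trans_le (h.live_card_le v)
  have hcost : cost (minDeg β) y ≤ utility (fun v => 2 ^ p.K * degR β v) y / 4 := by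
    refine cost_le_of_demand_le (fun v => Nat.cast_nonneg _) (shares_nonneg _ _) fun w => ?_
    calc ∑ u, y u w ≤ ∑ u, if ident u ∈ (β w).live then (2 : ℝ) ^ p.K / (4 * (β w).deg) else 0 := by
          refine Finset.sum_le_sum fun u _ => ?_
          rw [hyv]
          by_cases hp : Proposable G g β u w
          · rw [if_pos hp, if_pos ((h.ident_mem_live hs.inj w u).2 hp.2.1.symm)]
            have h1 : (0 : ℝ) < (β w).deg := by exact_mod_cast hdeg w u hp.2.1.symm
            have h2 : ((β w).deg : ℝ) ≤ (β u).deg := by exact_mod_cast hp.2.2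
            calc ((2 ^ p.K / (4 * (β u).deg) : ℕ) : ℝ) ≤ 2 ^ p.K / (4 * (β u).deg) := by
                  refine Nat.cast_div_le.trans (le_of_eq ?_)
                  push_cast
                  rfl
              _ ≤ _ := by gcongr
          · rw [if_neg hp]
            split_ifs
            · positivity
            · exact le_rfl
      _ = ((Finset.univ.filter fun u => ident u ∈ (β w).live).card : ℝ) *
            (2 ^ p.K / (4 * (β w).deg)) := by
          rw [← Finset.sum_filter, Finset.sum_const, nsmul_eq_mul]
      _ ≤ (β w).deg * (2 ^ p.K / (4 * (β w).deg)) := by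
          refine mul_le_mul_of_nonneg_right ?_ (by positivity)
          have : (Finset.univ.filter fun u => ident u ∈ (β w).live).card ≤ (β w).live.card :=
            Finset.card_le_card_of_injOn ident (fun u hu => by simpa using hu)
              (fun a _ b _ hab => hs.inj hab)
          exact_mod_cast this.trans (h.live_card_le w)
      _ ≤ 2 ^ p.K / 4 := by
          rcases Nat.eq_zero_or_pos (β w).deg with h0 | h0
          · rw [h0]
            simp only [Nat.cast_zero, zero_mul]
            positivity
          · have : (0 : ℝ) < (β w).deg := by exact_mod_cast h0
            refine le_of_eq ?_
            field_simp
  have hutil : (2 ^ p.K : ℝ) ^ 2 *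
      ((∑ v, ∑ w, if Proposable G g β v w then 1 else 0 : ℕ) : ℝ) / 8 ≤
        utility (fun v => 2 ^ p.K * degR β v) y := by
    push_cast
    rw [utility, Finset.mul_sum, Finset.sum_div]
    refine Finset.sum_le_sum fun v _ => ?_
    rw [Finset.mul_sum, Finset.sum_div]
    refine Finset.sum_le_sum fun w _ => ?_
    rw [hyv]
    split_ifs with hp
    · have h1 := hdeg v w hp.2.1
      have h2 : 4 * (β v).deg ≤ 2 ^ p.K :=
        (Nat.mul_le_mul_left _ (h.deg_le v)).trans hs.card_le
      have h3 : 2 ^ p.K ≤ 8 * ((β v).deg * (2 ^ p.K / (4 * (β v).deg))) := by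
        have h4 : 1 ≤ 2 ^ p.K / (4 * (β v).deg) := (Nat.one_le_div_iff (by omega)).2 h2
        have h5 := Nat.lt_mul_div_succ (2 ^ p.K) (show 0 < 4 * (β v).deg by omega)
        nlinarith
      have h6 : (2 : ℝ) ^ p.K ≤
          8 * ((β v).deg * ((2 ^ p.K / (4 * (β v).deg) : ℕ) : ℝ)) := by exact_mod_cast h3
      have h7 : (0 : ℝ) < 2 ^ p.K := by positivity
      unfold degR
      nlinarith
    · simp
  have hf := p.factor_zero_le
  have hc0 : 0 ≤ cost (minDeg β) y := costOn_nonneg _ (minDeg_nonneg β) (shares_nonneg _ _)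
  have h1 := mul_le_mul_of_nonneg_right hf hc0
  unfold objective
  rw [← hy]
  push_cast at hutil ⊢
  linarith

/-- The situation when the proposals have been announced. -/
structure Proposed (G : SimpleGraph V) (ident : V → ℕ) (p : Params) (g : Gender) (β : V → Base)
    (st : V → Node) : Prop where
  base_eq : ∀ v, (st v).base = β v
  level : ∀ v, Level g p.K p.K (st v)
  shared : Shared ident st

theorem Proposed.proposable {g : Gender} {β : V → Base} {st : V → Node}
    (h : Proposed G ident p g β st) (hβ : DegOK G ident β) (hid : Function.Injective ident)
    {v w : V} (hvw : Proposes ident st v w) : Proposable G g β v w := by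
  rw [← hβ.ident_mem_targets hid, ← h.base_eq v]
  exact (h.level v).support _ (by rw [hvw]; exact List.mem_singleton_self _)

theorem Proposed.mem_proposals {g : Gender} {β : V → Base} {st : V → Node}
    (h : Proposed G ident p g β st) (hβ : DegOK G ident β) (hid : Function.Injective ident)
    (w : V) (j : ℕ) : j ∈ (st w).proposals ↔ ∃ v, Proposes ident st v w ∧ ident v = j := by
  rw [Node.proposals, Finset.mem_filter, h.base_eq w, hβ.mem_nbrs]
  constructor
  · rintro ⟨⟨v, _, rfl⟩, hpos⟩
    rw [h.shared v w, (h.level v).weight_final] at hpos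
    refine ⟨v, ?_, rfl⟩
    by_contra hc
    rw [if_neg hc] at hpos
    exact lt_irrefl _ hpos
  · rintro ⟨v, hv, rfl⟩
    refine ⟨⟨v, (h.proposable hβ hid hv).2.1.1.symm, rfl⟩, ?_⟩
    rw [h.shared v w, (h.level v).weight_final, if_pos hv]
    positivity

/-- `w` accepts the proposal of `v`. -/
def Accepts (ident : V → ℕ) (st : V → Node) (w v : V) : Prop := (st w).best = some (ident v)

theorem Proposed.accepts_spec {g : Gender} {β : V → Base} {st : V → Node}
    (h : Proposed G ident p g β st) (hβ : DegOK G ident β) (hid : Function.Injective ident)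
    {w v : V} (hwv : Accepts ident st w v) :
    Proposes ident st v w ∧ ∀ u, Proposes ident st u w → (β u).deg ≤ (β v).deg := by
  unfold Accepts Node.best at hwv
  split_ifs at hwv with hne
  have hspec := ((st w).proposals.exists_max_image (st w).base.nbrDeg hne).choose_spec
  rw [Option.some.inj hwv] at hspec
  obtain ⟨v', hv', he⟩ := (h.mem_proposals hβ hid w _).1 hspec.1
  have hv : Proposes ident st v w := hid he ▸ hv'
  refine ⟨hv, fun u hu => ?_⟩
  have := hspec.2 (ident u) ((h.mem_proposals hβ hid w _).2 ⟨u, hu, rfl⟩)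
  rwa [h.base_eq w, hβ.nbrDeg_eq w u (h.proposable hβ hid hu).2.1.1.symm,
    hβ.nbrDeg_eq w v (h.proposable hβ hid hv).2.1.1.symm] at this

theorem Proposed.exists_accepts {g : Gender} {β : V → Base} {st : V → Node}
    (h : Proposed G ident p g β st) (hβ : DegOK G ident β) (hid : Function.Injective ident)
    {w v : V} (hvw : Proposes ident st v w) : ∃ v', Accepts ident st w v' := by
  have hne : (st w).proposals.Nonempty := ⟨ident v, (h.mem_proposals hβ hid w _).2 ⟨v, hvw, rfl⟩⟩
  have hspec := ((st w).proposals.exists_max_image (st w).base.nbrDeg hne).choose_spec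
  obtain ⟨v', _, he⟩ := (h.mem_proposals hβ hid w _).1 hspec.1
  refine ⟨v', ?_⟩
  unfold Accepts Node.best
  rw [dif_pos hne, he]

theorem Proposed.best_cases {g : Gender} {β : V → Base} {st : V → Node}
    (h : Proposed G ident p g β st) (hβ : DegOK G ident β) (hid : Function.Injective ident)
    (w : V) : (st w).best = none ∨ ∃ v, Accepts ident st w v := by
  by_cases hne : (st w).proposals.Nonempty
  · obtain ⟨j, hj⟩ := hne
    obtain ⟨v, hv, _⟩ := (h.mem_proposals hβ hid w j).1 hj
    exact Or.inr (h.exists_accepts hβ hid hv)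
  · left
    unfold Node.best
    rw [dif_neg hne]

/-- Accepting makes a target and its proposer partners of each other, and does not affect anyone
else. -/
theorem Proposed.mate_acceptOp {g : Gender} {β : V → Base} {st : V → Node}
    (h : Proposed G ident p g β st) (hβ : DegOK G ident β) (hs : Setting ident p L) :
    (∀ v w, Accepts ident st w v →
      (acceptOp.apply G ident L st w).base.mate = some (ident v) ∧
      (acceptOp.apply G ident L st v).base.mate = some (ident w)) ∧
    ∀ v, (∀ w, ¬ Accepts ident st w v) → (∀ w, ¬ Accepts ident st v w) →
      (acceptOp.apply G ident L st v).base.mate = (β v).mate := by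
  set buf : V → ℕ → ℕ := fun v j =>
    received G ident L (fun u k => if (st u).best = some k then 1 else 0) v j with hbuf
  have hmate : ∀ v, (acceptOp.apply G ident L st v).base.mate = (st v).best.or
      (((st v).base.nbrs.filter fun j => buf v j = 1).sort.head?.or (st v).base.mate) := by
    intro v
    rfl
  have hmem : ∀ v j, j ∈ ((st v).base.nbrs.filter fun j => buf v j = 1) ↔
      ∃ w, Accepts ident st w v ∧ ident w = j := by
    intro v j
    rw [Finset.mem_filter, h.base_eq v, hβ.mem_nbrs]
    have hval : ∀ w, G.Adj v w →
        buf v (ident w) = if (st w).best = some (ident v) then 1 else 0 := fun w hvw =>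
      received_of_adj hs.inj hvw (hs.pow_lt (by
        split_ifs
        · exact Nat.one_le_two_pow
        · exact Nat.zero_le _))
    constructor
    · rintro ⟨⟨w, hvw, rfl⟩, hb⟩
      rw [hval w hvw] at hb
      refine ⟨w, ?_, rfl⟩
      by_contra hc
      rw [if_neg (show ¬ (st w).best = some (ident v) from hc)] at hb
      exact zero_ne_one hb
    · rintro ⟨w, hw, rfl⟩
      have hadj := (h.proposable hβ hs.inj (h.accepts_spec hβ hs.inj hw).1).2.1.1
      exact ⟨⟨w, hadj, rfl⟩, by
        rw [hval w hadj, if_pos (show (st w).best = some (ident v) from hw)]⟩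
  constructor
  · intro v w hwv
    have hpr := (h.accepts_spec hβ hs.inj hwv).1
    have hprop := h.proposable hβ hs.inj hpr
    refine ⟨by rw [hmate, hwv, Option.some_or], ?_⟩
    -- A proposer cannot receive proposals, because its neighbours are of the other gender.
    have hnone : (st v).best = none := by
      refine (h.best_cases hβ hs.inj v).resolve_right ?_
      rintro ⟨u, hu⟩
      have h1 := h.proposable hβ hs.inj (h.accepts_spec hβ hs.inj hu).1
      exact hβ.gender_ne u v h1.2.1.1 (h1.1.trans hprop.1.symm)
    have hsingle : ((st v).base.nbrs.filter fun j => buf v j = 1) = {ident w} := by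
      ext j
      rw [hmem, Finset.mem_singleton]
      constructor
      · rintro ⟨w', hw', rfl⟩
        rw [(h.accepts_spec hβ hs.inj hw').1.unique hs.inj hpr]
      · rintro rfl
        exact ⟨w, hwv, rfl⟩
    rw [hmate, hnone, hsingle, Finset.sort_singleton, Option.none_or, List.head?_cons,
      Option.some_or]
  · intro v h1 h2
    have hnone : (st v).best = none :=
      (h.best_cases hβ hs.inj v).resolve_right fun ⟨u, hu⟩ => h2 u hu
    have hempty : ((st v).base.nbrs.filter fun j => buf v j = 1) = ∅ := by
      ext j
      rw [hmem]
      simp only [Finset.notMem_empty, iff_false]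
      rintro ⟨w, hw, _⟩
      exact h1 w hw
    rw [hmate, hnone, hempty, Finset.sort_empty, List.head?_nil, Option.none_or, Option.none_or,
      h.base_eq v]

open Classical in
/-- The degrees of the accepted proposers add up to a constant fraction of the number of edges along
which a proposal was possible. -/
theorem Proposed.gain {g : Gender} {β : V → Base} {st : V → Node}
    (h : Proposed G ident p g β st) (hβ : DegOK G ident β) (hs : Setting ident p L)
    (hobj : (2 ^ p.K : ℝ) ^ 2 * ((∑ v, ∑ w, if Proposable G g β v w then 1 else 0 : ℕ) : ℝ) / 16 ≤
      objective ident (2 ^ p.K) β 1 st) :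
    (∑ v, ∑ w, if Proposable G g β v w then 1 else 0) ≤
      16 * ∑ v, if ∃ w, Accepts ident st w v then (β v).deg else 0 := by
  set b : V → V := fun w => if hw : ∃ v, Accepts ident st w v then hw.choose else w with hb
  have hbacc : ∀ w, (∃ v, Proposes ident st v w) → Accepts ident st w (b w) := by
    rintro w ⟨v, hv⟩
    have hw := h.exists_accepts hβ hs.inj hv
    simp only [hb, dif_pos hw]
    exact hw.choose_spec
  have hint := objective_le_of_integral (N := (2 : ℝ) ^ p.K) (D := degR β)
    (fun v => Nat.cast_nonneg _) (Proposes ident st) (shares ident st)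
    (fun v w => by
      rw [shares, (h.level v).weight_final]
      split_ifs <;> simp) b
    (fun w hw => by
      obtain ⟨h1, h2⟩ := h.accepts_spec hβ hs.inj (hbacc w hw)
      exact ⟨h1, fun u hu => Nat.cast_le.2 (h2 u hu)⟩)
  have hsum : (∑ w, if ∃ v, Proposes ident st v w then (β (b w)).deg else 0) ≤
      ∑ v, if ∃ w, Accepts ident st w v then (β v).deg else 0 := by
    rw [← Finset.sum_filter, ← Finset.sum_filter]
    have hinj : ∀ w ∈ Finset.univ.filter (fun w => ∃ v, Proposes ident st v w),
        ∀ w' ∈ Finset.univ.filter (fun w => ∃ v, Proposes ident st v w), b w = b w' → w = w' := by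
      intro w hw w' hw' he
      have h1 := (h.accepts_spec hβ hs.inj (hbacc w (Finset.mem_filter.1 hw).2)).1
      have h2 := (h.accepts_spec hβ hs.inj (hbacc w' (Finset.mem_filter.1 hw').2)).1
      rw [he] at h1
      exact h1.unique hs.inj h2
    rw [← Finset.sum_image (f := fun v => (β v).deg) (g := b) hinj]
    refine Finset.sum_le_sum_of_subset fun v hv => ?_
    obtain ⟨w, hw, rfl⟩ := Finset.mem_image.1 hv
    exact Finset.mem_filter.2 ⟨Finset.mem_univ _, w, hbacc w (Finset.mem_filter.1 hw).2⟩
  have hN : (0 : ℝ) < (2 ^ p.K) ^ 2 := by positivity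
  have hcast : (∑ w, if ∃ v, Proposes ident st v w then degR β (b w) else 0) =
      ((∑ w, if ∃ v, Proposes ident st v w then (β (b w)).deg else 0 : ℕ) : ℝ) := by
    push_cast
    rfl
  rw [hcast] at hint
  have hobj' : objective ident (2 ^ p.K) β 1 st =
      utility (fun v => 2 ^ p.K * degR β v) (shares ident st) -
        1 / 2 * cost (minDeg β) (shares ident st) := by
    unfold objective
    push_cast
    rfl
  have h1 := (hobj.trans hobj'.le).trans hint
  rw [mul_div_assoc] at h1
  have h2 := le_of_mul_le_mul_left h1 hN
  rw [div_le_iff₀ (by norm_num : (0 : ℝ) < 16)] at h2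
  have h3 : (∑ v, ∑ w, if Proposable G g β v w then 1 else 0) ≤
      (∑ w, if ∃ v, Proposes ident st v w then (β (b w)).deg else 0) * 16 := by
    exact_mod_cast h2
  omega

end Phase

section Iterations

variable {V : Type} {G : SimpleGraph V} {ident : V → ℕ} {p : Params} {L : ℕ}

/-- After `refreshOp`, the sets of live neighbours are up to date. -/
theorem netOK_refreshOp {st : V → Node} (hid : Function.Injective ident) (hL : 0 < L)
    (h1 : ∀ v, (st v).base.ident = ident v)
    (h2 : ∀ v j, j ∈ (st v).base.nbrs ↔ ∃ u, G.Adj v u ∧ ident u = j)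
    (h3 : ∀ v u, G.Adj v u → (st v).base.gender ≠ (st u).base.gender)
    (h4 : ∀ v j, (st v).base.mate = some j →
      ∃ u, ident u = j ∧ G.Adj v u ∧ (st u).base.mate = some (ident v)) :
    NetOK G ident (fun v => (refreshOp.apply G ident L st v).base) where
  ident_eq := h1
  mem_nbrs := h2
  gender_ne := h3
  mate_symm := h4
  mem_live v j := by
    set f : V → ℕ → ℕ := fun u _ => if (st u).base.mate.isSome then 1 else 0 with hf
    have hlive : (refreshOp.apply G ident L st v).base.live =
        if (st v).base.mate.isSome then ∅
        else (st v).base.nbrs.filter fun j => received G ident L f v j = 0 := rfl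
    have hval : ∀ u, G.Adj v u → received G ident L f v (ident u) = f u (ident v) := fun u hvu =>
      received_of_adj hid hvu (by
        have := Nat.one_lt_two_pow hL.ne'
        simp only [hf]
        split_ifs <;> omega)
    change j ∈ (refreshOp.apply G ident L st v).base.live ↔
      ∃ u, (G.Adj v u ∧ (st v).base.mate = none ∧ (st u).base.mate = none) ∧ ident u = j
    rw [hlive]
    cases hm : (st v).base.mate with
    | some x => simp
    | none =>
      simp only [Option.isSome_none, Bool.false_eq_true, if_false, Finset.mem_filter, h2,
        true_and]
      constructor
      · rintro ⟨⟨u, hvu, rfl⟩, h0⟩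
        rw [hval u hvu] at h0
        refine ⟨u, ⟨hvu, ?_⟩, rfl⟩
        cases hu : (st u).base.mate with
        | none => rfl
        | some x => simp [hf, hu] at h0
      · rintro ⟨u, ⟨hvu, hu⟩, rfl⟩
        exact ⟨⟨u, hvu, rfl⟩, by rw [hval u hvu]; simp [hf, hu]⟩

variable [Fintype V]

open Classical in
/-- The result of a phase. -/
structure PhaseResult (G : SimpleGraph V) (ident : V → ℕ) (g : Gender) (β β' : V → Base) :
    Prop where
  degOK : DegOK G ident β'
  deg_eq : ∀ v, (β' v).deg = (β v).deg
  gender_eq : ∀ v, (β' v).gender = (β v).gender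
  mate_mono : ∀ v, (β' v).mate = none → (β v).mate = none
  gain : (∑ v, ∑ w, if Proposable G g β v w then 1 else 0) ≤
    16 * ∑ v, if (β v).gender = g ∧ (β v).mate = none ∧ (β' v).mate ≠ none then (β v).deg else 0

open Classical in
theorem phaseOps_spec {β : V → Base} {st : V → Node} (hb : ∀ v, (st v).base = β v)
    (hβ : DegOK G ident β) (hs : Setting ident p L) (g : Gender) :
    PhaseResult G ident g β (fun v => (runOps G ident L (p.phaseOps g) st v).base) := by
  obtain ⟨h1, h2, h3⟩ := roundingOps_spec (G := G) (L := L) (p := p) (g := g) (β := β)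
    (st := (startOp g (2 ^ p.K)).apply G ident L st) hb
    (fun v => hβ.level_startOp hb g v) hβ.baseOK hs
  set st₁ := runOps G ident L p.roundingOps ((startOp g (2 ^ p.K)).apply G ident L st)
  have hr : Rounding G ident p g β st₁ := ⟨h1, fun v => ⟨_, h2 v⟩⟩
  set st₂ := shareOp.apply G ident L st₁ with hst₂
  have hP : Proposed G ident p g β st₂ :=
    ⟨h1, fun v => ⟨(h2 v).le, (h2 v).scale_eq, (h2 v).length_eq, (h2 v).support⟩,
      hr.shared_shareOp hβ.baseOK hs⟩
  have hobj := (hβ.le_objective_startOp hb hs g).trans h3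
  have hgain := hP.gain hβ hs hobj
  obtain ⟨hm1, hm2⟩ := hP.mate_acceptOp hβ hs
  have hrun : runOps G ident L (p.phaseOps g) st =
      refreshOp.apply G ident L (acceptOp.apply G ident L st₂) := by
    rw [Params.phaseOps, runOps_append, runOps_append]
    rfl
  rw [hrun]
  set st₃ := acceptOp.apply G ident L st₂ with hst₃
  have hacc : ∀ v, (∃ u, (Accepts ident st₂ v u ∨ Accepts ident st₂ u v) ∧
      (st₃ v).base.mate = some (ident u)) ∨ (st₃ v).base.mate = (β v).mate := by
    intro v
    by_cases h1 : ∃ w, Accepts ident st₂ w v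
    · obtain ⟨w, hw⟩ := h1
      exact Or.inl ⟨w, Or.inr hw, (hm1 v w hw).2⟩
    by_cases h2 : ∃ w, Accepts ident st₂ v w
    · obtain ⟨w, hw⟩ := h2
      exact Or.inl ⟨w, Or.inl hw, (hm1 w v hw).1⟩
    exact Or.inr (hm2 v (fun w hw => h1 ⟨w, hw⟩) fun w hw => h2 ⟨w, hw⟩)
  have hlive : ∀ w v, Accepts ident st₂ w v → Proposable G g β v w := fun w v hwv =>
    hP.proposable hβ hs.inj (hP.accepts_spec hβ hs.inj hwv).1
  have hmono : ∀ v, (st₃ v).base.mate = none → (β v).mate = none := by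
    intro v hv
    rcases hacc v with ⟨u, _, hu⟩ | h
    · rw [hv] at hu
      exact absurd hu (by simp)
    · exact h ▸ hv
  have hnbrs : ∀ v, (st₃ v).base.nbrs = (β v).nbrs := fun v => by rw [← hP.base_eq v]; rfl
  have hgen : ∀ v, (st₃ v).base.gender = (β v).gender := fun v => by rw [← hP.base_eq v]; rfl
  have hdeg : ∀ v, (st₃ v).base.deg = (β v).deg := fun v => by rw [← hP.base_eq v]; rfl
  have hnd : ∀ v, (st₃ v).base.nbrDeg = (β v).nbrDeg := fun v => by rw [← hP.base_eq v]; rfl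
  have hide : ∀ v, (st₃ v).base.ident = (β v).ident := fun v => by rw [← hP.base_eq v]; rfl
  have hnet : NetOK G ident (fun v => (refreshOp.apply G ident L st₃ v).base) := by
    refine netOK_refreshOp hs.inj (Nat.zero_lt_of_lt hs.len)
      (fun v => (hide v).trans (hβ.ident_eq v))
      (fun v j => by rw [hnbrs]; exact hβ.mem_nbrs v j)
      (fun v u hvu => by rw [hgen, hgen]; exact hβ.gender_ne v u hvu) ?_
    intro v j hj
    rcases hacc v with ⟨u, hu, hvu⟩ | h
    · have hju : ident u = j := Option.some.inj (hvu.symm.trans hj)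
      rcases hu with hu | hu
      · exact ⟨u, hju, (hlive v u hu).2.1.1.symm, (hm1 u v hu).2⟩
      · exact ⟨u, hju, (hlive u v hu).2.1.1, (hm1 v u hu).1⟩
    · rw [h] at hj
      obtain ⟨u, hju, hadj, hu⟩ := hβ.mate_symm v j hj
      refine ⟨u, hju, hadj, ?_⟩
      rcases hacc u with ⟨w, hw, _⟩ | h'
      · exfalso
        rcases hw with hw | hw
        · have := (hlive u w hw).2.1.2.2
          rw [hu] at this
          exact absurd this (by simp)
        · have := (hlive w u hw).2.1.2.1
          rw [hu] at this
          exact absurd this (by simp)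
      · exact h'.trans hu
  refine ⟨⟨hnet, fun v u hvu => ?_, fun v => ?_, fun v => ?_⟩, hdeg, hgen, hmono, ?_⟩
  · change (st₃ v).base.nbrDeg (ident u) = (st₃ u).base.deg
    rw [hnd, hdeg]
    exact hβ.nbrDeg_eq v u hvu
  · change (st₃ v).base.deg ≤ _
    rw [hdeg]
    exact hβ.deg_le v
  · change _ ≤ (st₃ v).base.deg
    rw [hdeg]
    refine (Finset.card_le_card fun j hj => ?_).trans (hβ.live_card_le v)
    obtain ⟨u, hu, rfl⟩ := (hnet.mem_live v j).1 hj
    exact (hβ.mem_live v _).2 ⟨u, ⟨hu.1, hmono v hu.2.1, hmono u hu.2.2⟩, rfl⟩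
  · refine hgain.trans (Nat.mul_le_mul_left _ (Finset.sum_le_sum fun v _ => ?_))
    by_cases hv : ∃ w, Accepts ident st₂ w v
    · obtain ⟨w, hw⟩ := hv
      rw [if_pos ⟨w, hw⟩, if_pos]
      refine ⟨(hlive w v hw).1, (hlive w v hw).2.1.2.1, ?_⟩
      change (st₃ v).base.mate ≠ none
      rw [(hm1 v w hw).2]
      simp
    · rw [if_neg hv]
      exact Nat.zero_le _

/-! ### Iterations of the two phases -/

open Classical in
/-- The number of edges between unmatched processors. -/
noncomputable def liveEdges (G : SimpleGraph V) (β : V → Base) : ℕ :=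
  ∑ v, ∑ w, if (β v).gender = Gender.male ∧ LiveAdj G β v w then 1 else 0

open Classical in
theorem sum_liveAdj_eq_card {β : V → Base} (h : NetOK G ident β) (hid : Function.Injective ident)
    (v : V) : (∑ w, if LiveAdj G β v w then 1 else 0) = (β v).live.card := by
  rw [← Finset.card_filter, ← Finset.card_image_of_injective _ hid]
  congr 1
  ext j
  rw [h.mem_live]
  simp

theorem degOK_degreeOp {β : V → Base} {st : V → Node} (hb : ∀ v, (st v).base = β v)
    (h : NetOK G ident β) (hs : Setting ident p L) :
    DegOK G ident (fun v => (degreeOp.apply G ident L st v).base) := by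
  have hcard : ∀ v, (β v).live.card ≤ Fintype.card V := by
    classical
    intro v
    rw [← sum_liveAdj_eq_card h hs.inj, ← Finset.card_filter]
    exact Finset.card_le_univ _
  have hbase : ∀ v, (degreeOp.apply G ident L st v).base = { β v with
      deg := (β v).live.card
      nbrDeg := fun j => if 0 < 1 then
        received G ident L (fun u _ => (β u).live.card) v j else 0 } := by
    intro v
    have : ∀ u, (st u).base.live.card = (β u).live.card := fun u => by rw [hb]
    simp only [← this, ← hb v]
    rfl
  simp only [hbase]
  refine ⟨⟨h.ident_eq, h.mem_nbrs, h.gender_ne, h.mate_symm, h.mem_live⟩, fun v u hvu => ?_,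
    hcard, fun v => le_rfl⟩
  simp only [one_pos, if_true]
  refine received_of_adj hs.inj hvu (hs.pow_lt ((hcard u).trans (hs.card_le'.trans ?_)))
  exact Nat.pow_le_pow_right (by norm_num) (by omega)

theorem gender_eq_female {g : Gender} (h : g ≠ Gender.male) : g = Gender.female := by
  cases g
  · exact absurd rfl h
  · rfl

open Classical in
/-- Two phases, one for each gender as proposers, remove a constant fraction of the edges: in one of
the two directions at least half of the edges go from the larger to the smaller degree, and every
proposer who is matched removes as many edges as its degree says. -/
theorem liveEdges_two_phases {β₁ β₂ β₃ : V → Base} (h₁ : DegOK G ident β₁)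
    (hid : Function.Injective ident) (hdeg : ∀ v, (β₁ v).deg = (β₁ v).live.card)
    (h₂ : PhaseResult G ident Gender.male β₁ β₂) (h₃ : PhaseResult G ident Gender.female β₂ β₃) :
    33 * liveEdges G β₃ ≤ 32 * liveEdges G β₁ := by
  set R := ∑ v, ∑ w, if (β₁ v).gender = Gender.male ∧ LiveAdj G β₁ v w ∧ ¬ LiveAdj G β₃ v w
    then 1 else 0 with hR
  have hmono : ∀ v w, LiveAdj G β₃ v w → LiveAdj G β₂ v w := fun v w h =>
    ⟨h.1, h₃.mate_mono v h.2.1, h₃.mate_mono w h.2.2⟩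
  have hmono' : ∀ v w, LiveAdj G β₂ v w → LiveAdj G β₁ v w := fun v w h =>
    ⟨h.1, h₂.mate_mono v h.2.1, h₂.mate_mono w h.2.2⟩
  have hsum : liveEdges G β₃ + R = liveEdges G β₁ := by
    simp only [liveEdges, hR, ← Finset.sum_add_distrib]
    refine Finset.sum_congr rfl fun v _ => Finset.sum_congr rfl fun w _ => ?_
    rw [h₃.gender_eq, h₂.gender_eq]
    by_cases ha : (β₁ v).gender = Gender.male
    · by_cases hc : LiveAdj G β₃ v w
      · have := hmono' v w (hmono v w hc)
        simp [ha, hc, this]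
      · simp [ha, hc]
    · simp [ha]
  have hdegsum : ∀ v, (β₁ v).deg = ∑ w, if LiveAdj G β₁ v w then 1 else 0 := fun v =>
    (hdeg v).trans (sum_liveAdj_eq_card h₁.toNetOK hid v).symm
  have hsplit : liveEdges G β₁ ≤
      (∑ v, ∑ w, if Proposable G Gender.male β₁ v w then 1 else 0) +
      ∑ v, ∑ w, if Proposable G Gender.female β₁ v w then 1 else 0 := by
    rw [Finset.sum_comm (f := fun v w => if Proposable G Gender.female β₁ v w then 1 else 0)]
    simp only [liveEdges, ← Finset.sum_add_distrib]
    refine Finset.sum_le_sum fun v _ => Finset.sum_le_sum fun w _ => ?_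
    by_cases h : (β₁ v).gender = Gender.male ∧ LiveAdj G β₁ v w
    · rw [if_pos h]
      rcases le_total (β₁ w).deg (β₁ v).deg with hd | hd
      · rw [if_pos (show Proposable G Gender.male β₁ v w from ⟨h.1, h.2, hd⟩)]
        omega
      · have hw : (β₁ w).gender = Gender.female :=
          gender_eq_female fun hw => h₁.gender_ne v w h.2.1 (h.1.trans hw.symm)
        rw [if_pos (show Proposable G Gender.female β₁ w v from ⟨hw, h.2.symm, hd⟩)]
        omega
    · rw [if_neg h]
      exact Nat.zero_le _
  have hgain₂ : (∑ v, if (β₁ v).gender = Gender.male ∧ (β₁ v).mate = none ∧ (β₂ v).mate ≠ none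
      then (β₁ v).deg else 0) ≤ R := by
    refine Finset.sum_le_sum fun v _ => ?_
    split_ifs with h
    · rw [hdegsum]
      refine Finset.sum_le_sum fun w _ => ?_
      split_ifs with h' h'' h''
      · exact le_rfl
      · exact absurd ⟨h.1, h', fun hc => h.2.2 (hmono v w hc).2.1⟩ h''
      · exact Nat.zero_le _
      · exact le_rfl
    · exact Nat.zero_le _
  have hgain₃ : (∑ v, if (β₂ v).gender = Gender.female ∧ (β₂ v).mate = none ∧
      (β₃ v).mate ≠ none then (β₂ v).deg else 0) ≤ R := by
    rw [hR, Finset.sum_comm]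
    refine Finset.sum_le_sum fun w _ => ?_
    split_ifs with h
    · rw [h₂.deg_eq, hdegsum]
      refine Finset.sum_le_sum fun v _ => ?_
      split_ifs with h' h'' h''
      · exact le_rfl
      · refine absurd ⟨?_, h'.symm, fun hc => h.2.2 hc.2.2⟩ h''
        by_contra hv
        have hw : (β₁ w).gender = Gender.female := (h₂.gender_eq w).symm.trans h.1
        exact h₁.gender_ne w v h'.1 (hw.trans (gender_eq_female hv).symm)
      · exact Nat.zero_le _
      · exact le_rfl
    · exact Nat.zero_le _
  -- Edges that the first phase has not removed can still be used in the second one, since the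
  -- degrees are those from the start of the iteration.
  have hstable : (∑ v, ∑ w, if Proposable G Gender.female β₁ v w then 1 else 0) ≤
      (∑ v, ∑ w, if Proposable G Gender.female β₂ v w then 1 else 0) + R := by
    rw [hR, Finset.sum_comm (f := fun v w =>
      if (β₁ v).gender = Gender.male ∧ LiveAdj G β₁ v w ∧ ¬ LiveAdj G β₃ v w then 1 else 0)]
    simp only [← Finset.sum_add_distrib]
    refine Finset.sum_le_sum fun w _ => Finset.sum_le_sum fun v _ => ?_
    by_cases h : Proposable G Gender.female β₁ w v
    · rw [if_pos h]
      by_cases hc : LiveAdj G β₃ v w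
      · rw [if_pos (show Proposable G Gender.female β₂ w v from
          ⟨(h₂.gender_eq w).trans h.1, (hmono v w hc).symm, by
            rw [h₂.deg_eq, h₂.deg_eq]
            exact h.2.2⟩)]
        omega
      · have hv : (β₁ v).gender = Gender.male := by
          by_contra hv
          exact h₁.gender_ne w v h.2.1.1 (h.1.trans (gender_eq_female hv).symm)
        rw [if_pos (show (β₁ v).gender = Gender.male ∧ LiveAdj G β₁ v w ∧ ¬ LiveAdj G β₃ v w from
          ⟨hv, h.2.1.symm, hc⟩)]
        omega
    · rw [if_neg h]
      exact Nat.zero_le _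
  have g₂ := h₂.gain
  have g₃ := h₃.gain
  omega

theorem iterationOps_spec {β : V → Base} {st : V → Node} (hb : ∀ v, (st v).base = β v)
    (h : NetOK G ident β) (hs : Setting ident p L) :
    NetOK G ident (fun v => (runOps G ident L p.iterationOps st v).base) ∧
    33 * liveEdges G (fun v => (runOps G ident L p.iterationOps st v).base) ≤
      32 * liveEdges G β := by
  rw [Params.iterationOps, runOps_append, runOps_append, runOps_cons, runOps_nil]
  have h₁ := degOK_degreeOp hb h hs
  set st₁ := degreeOp.apply G ident L st with hst₁
  have h₂ := phaseOps_spec (fun v => rfl) h₁ hs Gender.male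
  set st₂ := runOps G ident L (p.phaseOps Gender.male) st₁
  have h₃ := phaseOps_spec (fun v => rfl) h₂.degOK hs Gender.female
  have hlive : liveEdges G (fun v => (st₁ v).base) = liveEdges G β := by
    have hβ : β = fun v => (st v).base := funext fun v => (hb v).symm
    rw [hβ]
    rfl
  refine ⟨h₃.degOK.toNetOK, ?_⟩
  rw [← hlive]
  exact liveEdges_two_phases h₁ hs.inj (fun v => rfl) h₂ h₃

/-- The iterations leave no edge between unmatched processors, because `(33 / 32) ^ 33 ≥ 2`. -/
theorem ops_spec {st : V → Node} (h : NetOK G ident (fun v => (st v).base))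
    (hs : Setting ident p L) :
    NetOK G ident (fun v => (runOps G ident L p.ops st v).base) ∧
    liveEdges G (fun v => (runOps G ident L p.ops st v).base) = 0 := by
  have hiter : ∀ T, NetOK G ident (fun v =>
        (runOps G ident L ((List.range T).flatMap fun _ => p.iterationOps) st v).base) ∧
      33 ^ T * liveEdges G (fun v =>
        (runOps G ident L ((List.range T).flatMap fun _ => p.iterationOps) st v).base) ≤
      32 ^ T * liveEdges G (fun v => (st v).base) := by
    intro T
    induction T with
    | zero => exact ⟨h, le_rfl⟩
    | succ T ih =>
      rw [runOps_flatMap_succ]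
      obtain ⟨h1, h2⟩ := iterationOps_spec (fun v => rfl) ih.1 hs
      refine ⟨h1, ?_⟩
      rw [pow_succ, pow_succ]
      calc _ = 33 ^ T * (33 * _) := mul_assoc _ _ _
        _ ≤ 33 ^ T * (32 * _) := Nat.mul_le_mul_left _ h2
        _ = 32 * (33 ^ T * _) := by ring
        _ ≤ 32 * (32 ^ T * _) := Nat.mul_le_mul_left _ ih.2
        _ = _ := by ring
  obtain ⟨h1, h2⟩ := hiter (66 * p.K)
  refine ⟨h1, ?_⟩
  have h0 : liveEdges G (fun v => (st v).base) < 2 ^ (2 * p.K) := by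
    calc liveEdges G (fun v => (st v).base) ≤ ∑ _v : V, ∑ _w : V, 1 := by
          refine Finset.sum_le_sum fun v _ => Finset.sum_le_sum fun w _ => ?_
          split_ifs <;> omega
      _ = Fintype.card V * Fintype.card V := by simp
      _ < 2 ^ p.K * 2 ^ p.K := by
          have := hs.card_le
          have hpos : 0 < 2 ^ p.K := by positivity
          exact Nat.mul_lt_mul'' (by omega) (by omega)
      _ = 2 ^ (2 * p.K) := by ring
  rw [show (33 : ℕ) ^ (66 * p.K) = (33 ^ 33) ^ (2 * p.K) by rw [← pow_mul]; congr 1; ring,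
    show (32 : ℕ) ^ (66 * p.K) = (32 ^ 33) ^ (2 * p.K) by rw [← pow_mul]; congr 1; ring] at h2
  by_contra hne
  have hge := Nat.one_le_iff_ne_zero.2 hne
  have h3 : 2 ^ (2 * p.K) * (32 ^ 33) ^ (2 * p.K) ≤ (33 ^ 33) ^ (2 * p.K) := by
    rw [← mul_pow]
    exact Nat.pow_le_pow_left (by norm_num) _
  have hpos : 0 < (32 ^ 33) ^ (2 * p.K) := by positivity
  have h4 : (33 ^ 33) ^ (2 * p.K) ≤
      (32 ^ 33) ^ (2 * p.K) * liveEdges G (fun v => (st v).base) :=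
    le_trans (Nat.le_mul_of_pos_right _ hge) h2
  have h5 := Nat.mul_lt_mul_of_pos_left h0 hpos
  rw [mul_comm (2 ^ (2 * p.K))] at h3
  exact absurd (h3.trans h4) (not_le.2 h5)

/-- When no edge is left between unmatched processors, the partners form a maximal matching. -/
theorem maximal_matching {β : V → Base} (h : NetOK G ident β) (hid : Function.Injective ident)
    (h0 : liveEdges G β = 0) :
    ∃ M : Set (Sym2 V), Maximal (IsMatching G) M ∧
      ∀ v j, (β v).mate = some j ↔ ∃ u, ident u = j ∧ s(v, u) ∈ M := by
  classical
  have hno : ∀ v w, ¬ LiveAdj G β v w := by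
    have hmale : ∀ v w, (β v).gender = Gender.male → ¬ LiveAdj G β v w := by
      intro v w hv hvw
      have h1 := Finset.sum_eq_zero_iff.1 (Finset.sum_eq_zero_iff.1 h0 v (Finset.mem_univ v)) w
        (Finset.mem_univ w)
      rw [if_pos ⟨hv, hvw⟩] at h1
      exact one_ne_zero h1
    intro v w hvw
    by_cases hv : (β v).gender = Gender.male
    · exact hmale v w hv hvw
    · refine hmale w v ?_ hvw.symm
      by_contra hw
      exact h.gender_ne v w hvw.1 ((gender_eq_female hv).trans (gender_eq_female hw).symm)
  set M : Set (Sym2 V) := {e | ∃ v u, e = s(v, u) ∧ G.Adj v u ∧ (β v).mate = some (ident u)}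
  have hpair : ∀ v u, (β v).mate = some (ident u) → G.Adj v u ∧ (β u).mate = some (ident v) := by
    intro v u hv
    obtain ⟨u', he, hadj, hm⟩ := h.mate_symm v _ hv
    rw [hid he] at hadj hm
    exact ⟨hadj, hm⟩
  have hmem : ∀ e ∈ M, ∀ v ∈ e, ∃ u, e = s(v, u) ∧ (β v).mate = some (ident u) := by
    rintro _ ⟨v, u, rfl, hadj, hm⟩ x hx
    rcases Sym2.mem_iff.1 hx with rfl | rfl
    · exact ⟨u, rfl, hm⟩
    · exact ⟨v, Sym2.eq_swap, (hpair v x hm).2⟩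
  refine ⟨M, ⟨⟨?_, ?_⟩, ?_⟩, ?_⟩
  · rintro _ ⟨v, u, rfl, hadj, _⟩
    exact hadj
  · intro e he f hf v hve hvf
    obtain ⟨u, rfl, hu⟩ := hmem e he v hve
    obtain ⟨u', rfl, hu'⟩ := hmem f hf v hvf
    rw [hid (Option.some.inj (hu.symm.trans hu'))]
  · intro M' hM' hle e he
    have key : ∀ v u, s(v, u) ∈ M' → (β v).mate ≠ none → s(v, u) ∈ M := by
      intro v u hvu hv
      obtain ⟨j, hj⟩ := Option.ne_none_iff_exists'.1 hv
      obtain ⟨w, rfl, hadj, _⟩ := h.mate_symm v j hj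
      have hw : s(v, w) ∈ M := ⟨v, w, rfl, hadj, hj⟩
      rw [hM'.2 _ hvu _ (hle hw) v (Sym2.mem_mk_left _ _) (Sym2.mem_mk_left _ _)]
      exact hw
    induction e using Sym2.ind with
    | _ v u =>
      by_cases hv : (β v).mate = none
      · by_cases hu : (β u).mate = none
        · exact absurd ⟨hM'.1 he, hv, hu⟩ (hno v u)
        · rw [Sym2.eq_swap] at he ⊢
          exact key u v he hu
      · exact key v u he hv
  · intro v j
    constructor
    · intro hj
      obtain ⟨u, rfl, hadj, _⟩ := h.mate_symm v j hj
      exact ⟨u, rfl, v, u, rfl, hadj, hj⟩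
    · rintro ⟨u, rfl, hu⟩
      obtain ⟨w, he, hw⟩ := hmem _ hu v (Sym2.mem_mk_left _ _)
      rw [Sym2.congr_right.1 he]
      exact hw

end Iterations

/-! ### Parameters and running time -/

/-- Suitable numbers of halvings and codes, for identifiers below `n ^ c`. -/
theorem exists_params (c n : ℕ) : ∃ p : Params, p.K = Nat.log 2 n + 4 ∧
    p.q₁ ≤ 12 * (c + 1) * p.K ^ 2 ∧ p.q₂ ≤ 36 * (c + 1) * p.K ∧
    ∀ ident : Player n → ℕ, ValidIds c ident → Setting ident p (4 * p.K + 2 * c + 14) := by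
  set K := Nat.log 2 n + 4 with hK
  have hKpos : 0 < K := by omega
  set d := c * (Nat.log 2 n + 1) with hd
  have hdK : d + 1 ≤ (c + 1) * K := by
    have : c * (Nat.log 2 n + 1) ≤ c * K := Nat.mul_le_mul_left _ (by omega)
    rw [Nat.succ_mul]
    omega
  -- Codewords of polynomials of degree at most `d` agree in at most `d ≤ q₁ / (6 K)` positions.
  obtain ⟨q₁, hp₁, hlt₁, hle₁⟩ := Nat.exists_prime_lt_and_le_two_mul (6 * K * (d + 1))
    (by positivity)
  -- The second code uses polynomials of degree at most `3 ≤ q₂ / (6 K)`, and `q₁ ^ 2 ≤ q₂ ^ 4`.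
  obtain ⟨q₂, hp₂, hlt₂, hle₂⟩ := Nat.exists_prime_lt_and_le_two_mul (18 * (c + 1) * K)
    (by positivity)
  have hq₁ : q₁ ≤ 12 * (c + 1) * K ^ 2 := by
    calc q₁ ≤ 2 * (6 * K * (d + 1)) := hle₁
      _ ≤ 2 * (6 * K * ((c + 1) * K)) :=
          Nat.mul_le_mul_left _ (Nat.mul_le_mul_left _ hdK)
      _ = _ := by ring
  have hq₂ : q₂ ≤ 36 * (c + 1) * K := by
    calc q₂ ≤ 2 * (18 * (c + 1) * K) := hle₂
      _ = _ := by ring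
  have hn : n < 2 ^ (Nat.log 2 n + 1) := Nat.lt_pow_succ_log_self (by norm_num) n
  have hM₁ : n ^ c ≤ q₁ ^ (d + 1) := by
    calc n ^ c ≤ (2 ^ (Nat.log 2 n + 1)) ^ c := Nat.pow_le_pow_left hn.le c
      _ = 2 ^ d := by rw [← pow_mul, mul_comm]
      _ ≤ q₁ ^ d := Nat.pow_le_pow_left hp₁.two_le d
      _ ≤ q₁ ^ (d + 1) := Nat.pow_le_pow_right hp₁.pos (by omega)
  have hM₂ : q₁ * q₁ ≤ q₂ ^ (3 + 1) := by
    have : q₁ ≤ q₂ ^ 2 := by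
      calc q₁ ≤ 12 * (c + 1) * K ^ 2 := hq₁
        _ ≤ (18 * (c + 1) * K) ^ 2 := by
            have h1 : c + 1 ≤ (c + 1) ^ 2 := Nat.le_self_pow (by norm_num) _
            calc 12 * (c + 1) * K ^ 2 ≤ 324 * (c + 1) ^ 2 * K ^ 2 :=
                  Nat.mul_le_mul_right _ (Nat.mul_le_mul (by norm_num) h1)
              _ = _ := by ring
        _ ≤ q₂ ^ 2 := Nat.pow_le_pow_left hlt₂.le 2
    calc q₁ * q₁ ≤ q₂ ^ 2 * q₂ ^ 2 := Nat.mul_le_mul this this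
      _ = _ := by ring
  obtain ⟨code₁, hc₁, ha₁⟩ := exists_code hp₁ hM₁
  obtain ⟨code₂, hc₂, ha₂⟩ := exists_code hp₂ hM₂
  refine ⟨⟨K, q₁, code₁, q₂, code₂⟩, rfl, hq₁, hq₂, fun ident hid => ?_⟩
  have hc2 : c + 1 ≤ 2 ^ c := Nat.lt_two_pow_self
  have hK2 : K ≤ 2 ^ K := Nat.lt_two_pow_self.le
  refine ⟨hid.1, hKpos, ?_, ?_, hp₁.pos, hp₂.pos, ?_, ?_, hc₁, hc₂, ?_, ?_⟩
  · have hcard : Fintype.card (Player n) = n + n := by simp [Player]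
    rw [hcard]
    have : 2 ^ K = 8 * 2 ^ (Nat.log 2 n + 1) := by rw [hK]; ring
    change 4 * (n + n) ≤ 2 ^ K
    omega
  · change 4 * K < 4 * K + 2 * c + 14
    omega
  · change q₁ * q₁ ≤ 2 ^ (4 * K + 2 * c + 14)
    have : q₁ ≤ 2 ^ (2 * K + c + 4) := by
      calc q₁ ≤ 12 * (c + 1) * K ^ 2 := hq₁
        _ ≤ 2 ^ 4 * 2 ^ c * (2 ^ K) ^ 2 := Nat.mul_le_mul (Nat.mul_le_mul (by norm_num) hc2)
            (Nat.pow_le_pow_left hK2 2)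
        _ = _ := by ring
    calc q₁ * q₁ ≤ 2 ^ (2 * K + c + 4) * 2 ^ (2 * K + c + 4) := Nat.mul_le_mul this this
      _ = 2 ^ (4 * K + 2 * c + 8) := by ring
      _ ≤ _ := Nat.pow_le_pow_right (by norm_num) (by omega)
  · change q₂ * q₂ ≤ 2 ^ (4 * K + 2 * c + 14)
    have : q₂ ≤ 2 ^ (K + c + 6) := by
      calc q₂ ≤ 36 * (c + 1) * K := hq₂
        _ ≤ 2 ^ 6 * 2 ^ c * 2 ^ K := Nat.mul_le_mul (Nat.mul_le_mul (by norm_num) hc2) hK2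
        _ = _ := by ring
    calc q₂ * q₂ ≤ 2 ^ (K + c + 6) * 2 ^ (K + c + 6) := Nat.mul_le_mul this this
      _ = 2 ^ (2 * K + 2 * c + 12) := by ring
      _ ≤ _ := Nat.pow_le_pow_right (by norm_num) (by omega)
  · intro u v huv
    calc 6 * K * _ ≤ 6 * K * (d + 1) := Nat.mul_le_mul_left _
          ((ha₁ _ (hid.2 u) _ (hid.2 v) huv).trans (Nat.le_succ d))
      _ ≤ q₁ := hlt₁.le
  · intro x hx x' hx' hne
    calc 6 * K * _ ≤ 6 * K * 3 := Nat.mul_le_mul_left _ (ha₂ x hx x' hx' hne)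
      _ = 18 * 1 * K := by ring
      _ ≤ 18 * (c + 1) * K :=
          Nat.mul_le_mul_right _ (Nat.mul_le_mul_left _ (Nat.le_add_left 1 c))
      _ ≤ q₂ := hlt₂.le

theorem opsTime_ops_le (c : ℕ) (p : Params) (hK : 0 < p.K) (h₁ : p.q₁ ≤ 12 * (c + 1) * p.K ^ 2)
    (h₂ : p.q₂ ≤ 36 * (c + 1) * p.K) :
    opsTime p.ops + 3 ≤ 700000 * (c + 1) ^ 2 * p.K ^ 4 := by
  rw [opsTime_ops]
  set x := (c + 1) ^ 2 * p.K ^ 2 with hx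
  have hx1 : 1 ≤ x := Nat.one_le_iff_ne_zero.2 (by positivity)
  have hc : c + 1 ≤ (c + 1) ^ 2 := Nat.le_self_pow (by norm_num) _
  have hk : p.K ≤ p.K ^ 2 := Nat.le_self_pow (by norm_num) _
  have e₁ : p.q₁ ≤ 12 * x := by
    refine h₁.trans ?_
    rw [hx, ← mul_assoc]
    exact Nat.mul_le_mul_right _ (Nat.mul_le_mul_left _ hc)
  have e₂ : p.q₂ ≤ 36 * x := by
    refine h₂.trans ?_
    rw [hx, ← mul_assoc]
    exact Nat.mul_le_mul (Nat.mul_le_mul_left _ hc) hk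
  have e₃ : p.q₂ * p.q₂ ≤ 1296 * x := by
    calc p.q₂ * p.q₂ ≤ (36 * (c + 1) * p.K) * (36 * (c + 1) * p.K) := Nat.mul_le_mul h₂ h₂
      _ = _ := by rw [hx]; ring
  have e₄ : 9 + p.q₁ + p.q₂ + p.q₂ * p.q₂ * 4 ≤ 5241 * x := by omega
  have e₅ : p.K * (9 + p.q₁ + p.q₂ + p.q₂ * p.q₂ * 4) ≤ 5241 * (p.K * x) := by
    calc _ ≤ p.K * (5241 * x) := Nat.mul_le_mul_left _ e₄
      _ = _ := by ring
  have e₆ : 1 ≤ p.K * x := Nat.mul_pos hK hx1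
  have e₇ : 1 ≤ p.K * (p.K * x) := Nat.mul_pos hK e₆
  calc 66 * p.K * (2 + 2 * (7 + p.K * (9 + p.q₁ + p.q₂ + p.q₂ * p.q₂ * 4))) + 3
      ≤ 66 * p.K * (10498 * (p.K * x)) + 3 :=
        Nat.add_le_add_right (Nat.mul_le_mul_left _ (by omega)) 3
    _ = 692868 * (p.K * (p.K * x)) + 3 := by ring
    _ ≤ 700000 * (p.K * (p.K * x)) := by omega
    _ = _ := by rw [hx]; ring

theorem findsMaximalMatching {n L : ℕ} {p : Params} {ident : Player n → ℕ}
    (hs : Setting ident p L) (G : SimpleGraph (Player n)) (hG : IsBipartite G)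
    (len : ℕ → ℕ) (prog : ℕ → List (Op Node)) (hlen : len n = L) (hprog : prog n = p.ops) :
    (programAlgorithm initialNode (fun s => s.base.mate) len prog).FindsMaximalMatching
      G ident := by
  classical
  have hrun := (programAlgorithm_run initialNode (fun s => s.base.mate) len prog G ident).1
  have hmem : ∀ v j, j ∈ (Finset.univ.filter (G.Adj v)).image ident ↔
      ∃ u, G.Adj v u ∧ ident u = j := by
    intro v j
    simp
  have hinit : NetOK G ident (fun v => (initialNode (gender v) (ident v)
      ((Finset.univ.filter (G.Adj v)).image ident)).base) := by
    refine ⟨fun v => rfl, fun v j => ?_, hG, fun v j hj => ?_, fun v j => ?_⟩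
    · exact hmem v j
    · exact absurd hj (by simp [initialNode])
    · change j ∈ (Finset.univ.filter (G.Adj v)).image ident ↔
        ∃ u, (G.Adj v u ∧ none = none ∧ none = none) ∧ ident u = j
      simp only [hmem, and_true]
  obtain ⟨h1, h2⟩ := ops_spec hinit hs
  obtain ⟨M, hM, hout⟩ := maximal_matching h1 hs.inj h2
  refine ⟨M, hM, fun v j => ?_⟩
  rw [← hout v j, hrun v, hlen, hprog]

/-! ### The counts of ASM -/

section Counts

variable {V σ : Type} [Fintype V]

/-- After `a` calls of `quantileMatch` and `b` calls of `proposalRound`, each of which takes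
`T + 3` rounds. -/
structure Counts (T B a b : ℕ) (e : Exec V σ) : Prop where
  quantileMatchCalls_eq : e.quantileMatchCalls = a
  proposalRoundCalls_eq : e.proposalRoundCalls = b
  rounds_eq : e.rounds = b * (T + 3)
  bits_le : e.bits ≤ B

theorem bits_communicate_le (G : SimpleGraph V) (ident : V → ℕ) {send : σ → ℕ → Option Message}
    (receive : σ → Inbox → σ) {B : ℕ} (hsend : ∀ s j, messageBits (send s j) ≤ B)
    {e : Exec V σ} (he : e.bits ≤ B) : (e.communicate G ident send receive).bits ≤ B := by
  refine max_le he (Finset.sup_le fun v _ => Finset.sup_le fun u _ => ?_)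
  split_ifs
  exacts [hsend _ _, Nat.zero_le _]

end Counts

section Asm

variable {MM : MatchingAlgorithm} {T B n : ℕ}

theorem counts_proposalRound
    (hT : ∀ (G : SimpleGraph (Player n)) ident, (MM.run G ident).rounds = T)
    (hB : ∀ (G : SimpleGraph (Player n)) ident, (MM.run G ident).bits ≤ B) (hB2 : 2 ≤ B)
    (G : SimpleGraph (Player n)) (ident : Player n → ℕ)
    {a b : ℕ} {e : Exec (Player n) PlayerState} (he : Counts T B a b e) :
    Counts T B a (b + 1) (proposalRound MM G ident e) := by
  have h1 : ∀ s j, messageBits (sendPropose s j) ≤ B := fun s j => by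
    unfold sendPropose
    split_ifs
    exacts [hB2, Nat.zero_le _]
  have h2 : ∀ s j, messageBits (sendAccept s j) ≤ B := fun s j => by
    unfold sendAccept
    split_ifs
    exacts [hB2, Nat.zero_le _]
  have h3 : ∀ s j, messageBits (sendReject s j) ≤ B := fun s j => by
    unfold sendReject
    split_ifs
    exacts [hB2, Nat.zero_le _]
  refine ⟨he.quantileMatchCalls_eq, congrArg (· + 1) he.proposalRoundCalls_eq, ?_, ?_⟩
  · simp only [proposalRound, matchAccepted, Exec.communicate, hT, he.rounds_eq]
    ring
  · refine bits_communicate_le G ident receiveReject h3 (max_le ?_ (hB _ _))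
    exact bits_communicate_le G ident receiveAccept h2
      (bits_communicate_le G ident receivePropose h1 he.bits_le)

theorem counts_quantileMatch
    (hT : ∀ (G : SimpleGraph (Player n)) ident, (MM.run G ident).rounds = T)
    (hB : ∀ (G : SimpleGraph (Player n)) ident, (MM.run G ident).bits ≤ B) (hB2 : 2 ≤ B)
    (G : SimpleGraph (Player n)) (ident : Player n → ℕ) (k : ℕ)
    {a b : ℕ} {e : Exec (Player n) PlayerState} (he : Counts T B a b e) :
    Counts T B (a + 1) (b + k) (quantileMatch MM k G ident e) := by
  have hiter : ∀ (j : ℕ) (b : ℕ) (e : Exec (Player n) PlayerState), Counts T B (a + 1) b e →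
      Counts T B (a + 1) (b + j) ((proposalRound MM G ident)^[j] e) := by
    intro j
    induction j with
    | zero => exact fun b e he => he
    | succ j ih =>
      intro b e he
      rw [Function.iterate_succ_apply]
      have := ih (b + 1) _ (counts_proposalRound hT hB hB2 G ident he)
      rwa [add_assoc, add_comm 1 j] at this
  exact hiter k b _
    ⟨congrArg (· + 1) he.quantileMatchCalls_eq, he.proposalRoundCalls_eq, he.rounds_eq, he.bits_le⟩

theorem counts_asm
    (hT : ∀ (G : SimpleGraph (Player n)) ident, (MM.run G ident).rounds = T)
    (hB : ∀ (G : SimpleGraph (Player n)) ident, (MM.run G ident).bits ≤ B) (hB2 : 2 ≤ B)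
    (P : Preferences n) (ident : Player n → ℕ) (ε : ℝ) :
    Counts T B ((Nat.log 2 n + 1) * numInner ε)
      ((Nat.log 2 n + 1) * numInner ε * numQuantiles ε) (asm MM P ident ε) := by
  set k := numQuantiles ε with hk
  have hiter : ∀ (j a : ℕ) (e : Exec (Player n) PlayerState), Counts T B a (a * k) e →
      Counts T B (a + j) ((a + j) * k) ((quantileMatch MM k P.graph ident)^[j] e) := by
    intro j
    induction j with
    | zero => exact fun a e he => he
    | succ j ih =>
      intro a e he
      rw [Function.iterate_succ_apply]
      have h1 := counts_quantileMatch hT hB hB2 P.graph ident k he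
      rw [← Nat.succ_mul] at h1
      have := ih (a + 1) _ h1
      rwa [add_assoc, add_comm 1 j] at this
  have hfold : ∀ (l : List ℕ) (a : ℕ) (e : Exec (Player n) PlayerState), Counts T B a (a * k) e →
      Counts T B (a + l.length * numInner ε) ((a + l.length * numInner ε) * k)
        (l.foldl (fun e i =>
          (quantileMatch MM k P.graph ident)^[numInner ε] (e.compute (testActive i))) e) := by
    intro l
    induction l with
    | nil =>
      intro a e he
      simpa using he
    | cons i l ih =>
      intro a e he
      rw [List.foldl_cons]
      have := ih (a + numInner ε) _ (hiter (numInner ε) a (e.compute (testActive i))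
        ⟨he.quantileMatchCalls_eq, he.proposalRoundCalls_eq, he.rounds_eq, he.bits_le⟩)
      have hl : a + numInner ε + l.length * numInner ε = a + (i :: l).length * numInner ε := by
        rw [List.length_cons]
        ring
      rwa [hl] at this
  have h := hfold (List.range (Nat.log 2 n + 1)) 0 (initialExec P ident ε)
    ⟨rfl, (Nat.zero_mul k).symm, by rw [Nat.zero_mul, Nat.zero_mul]; rfl, Nat.zero_le _⟩
  rw [List.length_range, zero_add] at h
  exact h

end Asm

/-- When `ε > 16`, the inner loop is empty; otherwise there are `O(ε⁻¹)` quantiles. -/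
theorem numQuantiles_le {ε : ℝ} (hε : 0 < ε) (h : numInner ε ≠ 0) :
    (numQuantiles ε : ℝ) ≤ 16 * ε⁻¹ := by
  have hinv : 0 < ε⁻¹ := inv_pos.2 hε
  have h8 : 0 < 8 * ε⁻¹ := by positivity
  rcases le_total 1 (8 * ε⁻¹) with h1 | h1
  · have := Nat.ceil_lt_add_one h8.le
    unfold numQuantiles
    linarith
  · have hk : numQuantiles ε = 1 := by
      refine le_antisymm (Nat.ceil_le.2 (by simpa using h1)) (Nat.ceil_pos.2 h8)
    have h2 : 1 ≤ numInner ε := Nat.one_le_iff_ne_zero.2 h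
    unfold numInner at h2
    rw [Nat.one_le_floor_iff, hk] at h2
    have h3 : 2 * (ε / 8)⁻¹ * ((1 : ℕ) : ℝ) = 16 * ε⁻¹ := by
      field_simp
      norm_num
    rw [hk, ← h3]
    simpa using h2

theorem numInner_le {ε : ℝ} (hε : 0 < ε) : (numInner ε : ℝ) ≤ 256 * ε⁻¹ ^ 2 := by
  by_cases h : numInner ε = 0
  · rw [h, Nat.cast_zero]
    positivity
  · have hk := numQuantiles_le hε h
    have h1 : (0 : ℝ) ≤ 2 * (ε / 8)⁻¹ := by positivity
    calc (numInner ε : ℝ) ≤ 2 * (ε / 8)⁻¹ * (numQuantiles ε : ℝ) :=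
          Nat.floor_le (mul_nonneg h1 (Nat.cast_nonneg _))
      _ ≤ 2 * (ε / 8)⁻¹ * (16 * ε⁻¹) := mul_le_mul_of_nonneg_left hk h1
      _ = _ := by
          field_simp
          norm_num

theorem log_two_add_le {n : ℕ} (hn : 2 ≤ n) : ((Nat.log 2 n + 4 : ℕ) : ℝ) ≤ 8 * Real.log n := by
  have h2 := Real.log_two_gt_d9
  have hn' : (2 : ℝ) ≤ n := by exact_mod_cast hn
  have h1 : Real.log 2 ≤ Real.log n := Real.log_le_log (by norm_num) hn'
  have h3 : (Nat.log 2 n : ℝ) * Real.log 2 ≤ Real.log n := by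
    rw [← Real.log_pow]
    refine Real.log_le_log (by positivity) ?_
    exact_mod_cast Nat.pow_log_le_self 2 (by omega)
  have h4 : (0 : ℝ) ≤ Nat.log 2 n := Nat.cast_nonneg _
  push_cast
  nlinarith

end AlmostStable

theorem mainTheorem2 (c : ℕ) :
    ∃ (MM : AlmostStable.MatchingAlgorithm) (C : ℝ),
      (∀ (n : ℕ), 2 ≤ n →
        ∀ (ident : AlmostStable.Player n → ℕ), AlmostStable.ValidIds c ident →
        ∀ (G : SimpleGraph (AlmostStable.Player n)), AlmostStable.IsBipartite G →
          MM.FindsMaximalMatching G ident ∧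
          ((MM.run G ident).rounds : ℝ) ≤ C * Real.log n ^ 4 ∧
          ((MM.run G ident).bits : ℝ) ≤ C * Real.log n) ∧
      (∀ (n : ℕ), 2 ≤ n →
        ∀ (ident : AlmostStable.Player n → ℕ), AlmostStable.ValidIds c ident →
        ∀ (P : AlmostStable.Preferences n) (ε : ℝ), 0 < ε →
          ((AlmostStable.asm MM P ident ε).rounds : ℝ) ≤ C * ε⁻¹ ^ 3 * Real.log n ^ 5 ∧
          ((AlmostStable.asm MM P ident ε).bits : ℝ) ≤ C * Real.log n ∧
          ((AlmostStable.asm MM P ident ε).quantileMatchCalls : ℝ) ≤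
            C * ε⁻¹ ^ 2 * Real.log n ∧
          ((AlmostStable.asm MM P ident ε).proposalRoundCalls : ℝ) ≤
            C * ε⁻¹ * ((AlmostStable.asm MM P ident ε).quantileMatchCalls : ℝ) ∧
          ((AlmostStable.asm MM P ident ε).rounds : ℝ) ≤
            C * Real.log n ^ 4 * ((AlmostStable.asm MM P ident ε).proposalRoundCalls : ℝ)) := by
  choose p hK hq₁ hq₂ hset using AlmostStable.exists_params c
  set len : ℕ → ℕ := fun n => 4 * (p n).K + 2 * c + 14 with hlen
  set MM := AlmostStable.programAlgorithm AlmostStable.initialNode (fun s => s.base.mate) len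
    (fun n => (p n).ops) with hMM
  have hrounds : ∀ (n : ℕ) (G : SimpleGraph (AlmostStable.Player n)) ident,
      (MM.run G ident).rounds = AlmostStable.opsTime (p n).ops := fun n G ident =>
    (AlmostStable.programAlgorithm_run _ _ _ _ G ident).2.1
  have hbits : ∀ (n : ℕ) (G : SimpleGraph (AlmostStable.Player n)) ident,
      (MM.run G ident).bits ≤ len n := fun n G ident =>
    (AlmostStable.programAlgorithm_run _ _ _ _ G ident).2.2
  set C₁ : ℝ := 4096 * (700000 * ((c : ℝ) + 1) ^ 2) with hC₁
  have hc1 : (1 : ℝ) ≤ (c : ℝ) + 1 := by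
    have : (0 : ℝ) ≤ c := Nat.cast_nonneg c
    linarith
  have hc2 : (c : ℝ) + 1 ≤ ((c : ℝ) + 1) ^ 2 := by nlinarith
  have hKle : ∀ n, 2 ≤ n → ((p n).K : ℝ) ≤ 8 * Real.log n := fun n hn => by
    rw [hK]
    exact AlmostStable.log_two_add_le hn
  have hlog : ∀ n : ℕ, 2 ≤ n → (0 : ℝ) ≤ Real.log n := fun n _ => Real.log_natCast_nonneg n
  have htime : ∀ n, 2 ≤ n →
      ((AlmostStable.opsTime (p n).ops + 3 : ℕ) : ℝ) ≤ C₁ * Real.log n ^ 4 := by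
    intro n hn
    have h1 := AlmostStable.opsTime_ops_le c (p n) (by rw [hK]; omega) (hq₁ n) (hq₂ n)
    have h2 : (((p n).K : ℝ)) ^ 4 ≤ (8 * Real.log n) ^ 4 :=
      pow_le_pow_left₀ (Nat.cast_nonneg _) (hKle n hn) 4
    calc ((AlmostStable.opsTime (p n).ops + 3 : ℕ) : ℝ)
        ≤ ((700000 * (c + 1) ^ 2 * (p n).K ^ 4 : ℕ) : ℝ) := Nat.cast_le.2 h1
      _ = 700000 * ((c : ℝ) + 1) ^ 2 * ((p n).K : ℝ) ^ 4 := by push_cast; ring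
      _ ≤ 700000 * ((c : ℝ) + 1) ^ 2 * (8 * Real.log n) ^ 4 :=
          mul_le_mul_of_nonneg_left h2 (by positivity)
      _ = _ := by rw [hC₁]; ring
  have hlenle : ∀ n, 2 ≤ n → (len n : ℝ) ≤ C₁ * Real.log n := by
    intro n hn
    have h1 : (1 : ℝ) ≤ (p n).K := by
      have : 1 ≤ (p n).K := by rw [hK]; omega
      exact_mod_cast this
    have h2 := hKle n hn
    have h3 : (len n : ℝ) = 4 * (p n).K + 2 * c + 14 := by
      simp only [hlen]
      push_cast
      ring
    have h4 : (len n : ℝ) ≤ 18 * ((c : ℝ) + 1) * (p n).K := by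
      rw [h3]
      nlinarith
    calc (len n : ℝ) ≤ 18 * ((c : ℝ) + 1) * (p n).K := h4
      _ ≤ 18 * ((c : ℝ) + 1) * (8 * Real.log n) :=
          mul_le_mul_of_nonneg_left h2 (by positivity)
      _ = 144 * (((c : ℝ) + 1) * Real.log n) := by ring
      _ ≤ 144 * (((c : ℝ) + 1) ^ 2 * Real.log n) := by
          have := mul_le_mul_of_nonneg_right hc2 (hlog n hn)
          linarith
      _ ≤ C₁ * Real.log n := by
          have := mul_nonneg (sq_nonneg ((c : ℝ) + 1)) (hlog n hn)
          rw [hC₁]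
          linarith
  have hC₁pos : 1 ≤ C₁ := by
    rw [hC₁]
    nlinarith
  have hCle : C₁ ≤ 32768 * C₁ := by linarith
  refine ⟨MM, 32768 * C₁, fun n hn ident hid G hG => ⟨?_, ?_, ?_⟩, fun n hn ident hid P ε hε => ?_⟩
  · exact AlmostStable.findsMaximalMatching (hset n ident hid) G hG _ _ rfl rfl
  · rw [hrounds]
    calc ((AlmostStable.opsTime (p n).ops : ℕ) : ℝ)
        ≤ ((AlmostStable.opsTime (p n).ops + 3 : ℕ) : ℝ) := Nat.cast_le.2 (Nat.le_add_right _ 3)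
      _ ≤ C₁ * Real.log n ^ 4 := htime n hn
      _ ≤ _ := mul_le_mul_of_nonneg_right hCle (pow_nonneg (hlog n hn) 4)
  · calc ((MM.run G ident).bits : ℝ) ≤ len n := Nat.cast_le.2 (hbits n G ident)
      _ ≤ C₁ * Real.log n := hlenle n hn
      _ ≤ _ := mul_le_mul_of_nonneg_right hCle (hlog n hn)
  · have hcnt := AlmostStable.counts_asm (hrounds n) (hbits n)
      (by simp only [hlen]; omega) P ident ε
    set e := AlmostStable.asm MM P ident ε
    have hl := hlog n hn
    have hinv : 0 < ε⁻¹ := inv_pos.2 hε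
    have hqm : (e.quantileMatchCalls : ℝ) ≤ 2048 * ε⁻¹ ^ 2 * Real.log n := by
      rw [hcnt.quantileMatchCalls_eq]
      push_cast
      have h1 : (Nat.log 2 n : ℝ) + 1 ≤ 8 * Real.log n := by
        have := AlmostStable.log_two_add_le hn
        push_cast at this
        linarith
      calc ((Nat.log 2 n : ℝ) + 1) * AlmostStable.numInner ε
          ≤ (8 * Real.log n) * (256 * ε⁻¹ ^ 2) :=
            mul_le_mul h1 (AlmostStable.numInner_le hε) (Nat.cast_nonneg _) (by positivity)
        _ = _ := by ring
    have hpr : (e.proposalRoundCalls : ℝ) ≤ 16 * ε⁻¹ * e.quantileMatchCalls := by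
      rw [hcnt.proposalRoundCalls_eq, hcnt.quantileMatchCalls_eq]
      by_cases h0 : AlmostStable.numInner ε = 0
      · simp [h0]
      · rw [Nat.cast_mul, mul_comm]
        exact mul_le_mul_of_nonneg_right (AlmostStable.numQuantiles_le hε h0) (Nat.cast_nonneg _)
    have hro : (e.rounds : ℝ) ≤ C₁ * Real.log n ^ 4 * e.proposalRoundCalls := by
      rw [hcnt.rounds_eq, ← hcnt.proposalRoundCalls_eq, Nat.cast_mul, mul_comm]
      exact mul_le_mul_of_nonneg_right (htime n hn) (Nat.cast_nonneg _)
    have hC0 : 0 ≤ C₁ * Real.log n ^ 4 := mul_nonneg (by linarith) (pow_nonneg hl 4)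
    refine ⟨?_, ?_, ?_, ?_, ?_⟩
    · calc (e.rounds : ℝ) ≤ C₁ * Real.log n ^ 4 * e.proposalRoundCalls := hro
        _ ≤ C₁ * Real.log n ^ 4 * (16 * ε⁻¹ * (2048 * ε⁻¹ ^ 2 * Real.log n)) :=
            mul_le_mul_of_nonneg_left (hpr.trans
              (mul_le_mul_of_nonneg_left hqm (by positivity))) hC0
        _ = _ := by ring
    · calc (e.bits : ℝ) ≤ len n := Nat.cast_le.2 hcnt.bits_le
        _ ≤ C₁ * Real.log n := hlenle n hn
        _ ≤ _ := mul_le_mul_of_nonneg_right hCle hl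
    · refine hqm.trans ?_
      have : 0 ≤ ε⁻¹ ^ 2 * Real.log n := by positivity
      nlinarith
    · refine hpr.trans ?_
      have : 0 ≤ ε⁻¹ * (e.quantileMatchCalls : ℝ) := by positivity
      nlinarith
    · refine hro.trans ?_
      refine mul_le_mul_of_nonneg_right ?_ (Nat.cast_nonneg _)
      exact mul_le_mul_of_nonneg_right hCle (pow_nonneg hl 4)
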